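/- Let $V$ be a real function on $\mathbb{Z}$ (resp. on $\mathbb{N}=\{1,2,\dots\}$), and let $H$ be the self-adjoint operator in $\ell^2(\mathbb{Z})$ (resp. $\ell^2(\mathbb{N})$, with Dirichlet boundary condition at $0$) given on its natural domain $\{\psi\in\ell^2 : H\psi\in\ell^2\}$ by $(H\psi)(n)=\psi(n-1)+\psi(n+1)+V(n)\psi(n)$ (in the half-line case $\psi(0)=0$, that is, $(H\psi)(1)=\psi(2)+V(1)\psi(1)$). For $z\in\mathbb{C}$ put $$A(n,z)=\begin{pmatrix} z-V(n) & -1\\ 1 & 0\end{pmatrix},$$ and let $T(n,m;z)=A(n,z)A(n-1,z)\cdots A(m+1,z)$ if $n>m$, $T(n,n;z)=I$, and $T(n,m;z)=T(m,n;z)^{-1}$ if $n<m$. Let $\|\cdot\|$ be the operator norm of $2\times2$ matrices for the Euclidean norm. For $p>0$ and $T>0$ define $$a(n,T)=\frac1T\int_0^\infty e^{-2t/T}\,|\langle e^{-itH}\delta_1,\delta_n\rangle|^2\,dt,\qquad \langle|X|^p\rangle(T)=\sum_n|n|^p\,a(n,T),$$ $$\beta^-(p)=\liminf_{T\to+\infty}\frac{\log\langle|X|^p\rangle(T)}{\log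 T}.$$ Suppose that there exist $C>0$, $E_0\in\mathbb{R}$ and $\theta\ge1$ such that $$\|T(n,1;E)\|\le C$$ for all $E\in\mathbb{R}$ and all $n\in\mathbb{Z}\setminus\{0\}$ (resp. all $n\in\mathbb{N}$) with $|n|\cdot|E-E_0|^{\theta}\le1$. Then for every $p>0$, $$\beta^-(p)\ge p-\frac1\theta .$$ -/

import Mathlib

open Filter MeasureTheory
open scoped ENNReal Matrix.Norms.L2Operator

noncomputable section

/-! ### Formal Schrödinger operators on the line and on the half-line -/

/-- The formal operator `(τu)(n) = u(n-1) + u(n+1) + V(n)u(n)` on sequences indexed by `ℤ`. -/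
def lineExpr (V : ℤ → ℝ) : (ℤ → ℂ) →ₗ[ℂ] (ℤ → ℂ) where
  toFun u n := u (n - 1) + u (n + 1) + (V n : ℂ) * u n
  map_add' u v := by ext n; simp only [Pi.add_apply]; ring
  map_smul' c u := by ext n; simp only [Pi.smul_apply, smul_eq_mul, RingHom.id_apply]; ring

/-- The formal operator on sequences indexed by `{1, 2, …}` with Dirichlet boundary condition
at `0`: `(τu)(n) = u(n-1) + u(n+1) + V(n)u(n)` for `n > 1`, and `(τu)(1) = u(2) + V(1)u(1)`. -/
def halfLineExpr (V : ℕ+ → ℝ) : (ℕ+ → ℂ) →ₗ[ℂ] (ℕ+ → ℂ) where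
  toFun u n := (if n = 1 then 0 else u (n - 1)) + u (n + 1) + (V n : ℂ) * u n
  map_add' u v := by ext n; simp only [Pi.add_apply]; split_ifs <;> ring
  map_smul' c u := by
    ext n; simp only [Pi.smul_apply, smul_eq_mul, RingHom.id_apply]; split_ifs <;> ring

/-- The Hilbert space `ℓ²(ι)` of square summable complex families. -/
abbrev EllTwo (ι : Type) : Type := lp (fun _ : ι => ℂ) 2

/-- The operator in `ℓ²(ι)` given by a formal operator `τ` on its natural domain
`{ψ ∈ ℓ²(ι) : τψ ∈ ℓ²(ι)}`. -/
def ellTwoOperator {ι : Type} (τ : (ι → ℂ) →ₗ[ℂ] (ι → ℂ)) : EllTwo ι →ₗ.[ℂ] EllTwo ι where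
  domain :=
    { carrier := {ψ | Memℓp (τ ψ) 2}
      add_mem' := by
        intro a b ha hb
        simp only [Set.mem_ofPred_eq, lp.coeFn_add, map_add] at *
        exact ha.add hb
      zero_mem' := by
        simp only [Set.mem_ofPred_eq, lp.coeFn_zero, map_zero]
        exact zero_memℓp
      smul_mem' := by
        intro c a ha
        simp only [Set.mem_ofPred_eq, lp.coeFn_smul, map_smul] at *
        exact ha.const_smul c }
  toFun :=
    { toFun := fun ψ => ⟨τ (ψ : EllTwo ι), ψ.2⟩
      map_add' := fun a b => by ext1; exact map_add τ _ _
      map_smul' := fun c a => by ext1; exact map_smul τ _ _ }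

/-- The Schrödinger operator `H` in `ℓ²(ℤ)` with potential `V`. -/
def lineOperator (V : ℤ → ℝ) : EllTwo ℤ →ₗ.[ℂ] EllTwo ℤ := ellTwoOperator (lineExpr V)

/-- The Schrödinger operator `H` in `ℓ²({1, 2, …})` with potential `V`. -/
def halfLineOperator (V : ℕ+ → ℝ) : EllTwo ℕ+ →ₗ.[ℂ] EllTwo ℕ+ := ellTwoOperator (halfLineExpr V)

/-! ### The unitary group `exp(-itH)` -/

section Group

variable {𝓗 : Type} [NormedAddCommGroup 𝓗] [InnerProductSpace ℂ 𝓗]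

/-- `U` is the strongly continuous one-parameter unitary group `t ↦ exp(-itH)`, that is, the one
whose infinitesimal generator is exactly `-iH` (domain included). -/
structure IsUnitaryGroupOf (H : 𝓗 →ₗ.[ℂ] 𝓗) (U : ℝ → 𝓗 →L[ℂ] 𝓗) : Prop where
  map_zero : U 0 = ContinuousLinearMap.id ℂ 𝓗
  map_add : ∀ s t : ℝ, U (s + t) = (U s).comp (U t)
  norm_map : ∀ (t : ℝ) (ψ : 𝓗), ‖U t ψ‖ = ‖ψ‖
  continuous : ∀ ψ : 𝓗, Continuous fun t : ℝ => U t ψ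
  generator : ∀ ψ φ : 𝓗,
    (ψ, φ) ∈ H.graph ↔ HasDerivAt (fun t : ℝ => U t ψ) (-(Complex.I • φ)) 0

open Classical in
/-- The unitary group `t ↦ exp(-itH)`. By Stone's theorem it exists exactly when `H` is
self-adjoint (and densely defined), and it is then unique. -/
def unitaryGroup (H : 𝓗 →ₗ.[ℂ] 𝓗) : ℝ → 𝓗 →L[ℂ] 𝓗 :=
  if h : ∃ U, IsUnitaryGroupOf H U then h.choose else fun _ => 0

theorem unitaryGroup_spec {H : 𝓗 →ₗ.[ℂ] 𝓗} (h : ∃ U, IsUnitaryGroupOf H U) :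
    IsUnitaryGroupOf H (unitaryGroup H) := by
  rw [unitaryGroup, dif_pos h]
  exact h.choose_spec

theorem IsUnitaryGroupOf.hasDerivAt {H : 𝓗 →ₗ.[ℂ] 𝓗} {U : ℝ → 𝓗 →L[ℂ] 𝓗}
    (hU : IsUnitaryGroupOf H U) {ψ φ : 𝓗} (h : (ψ, φ) ∈ H.graph) (t : ℝ) :
    HasDerivAt (fun s : ℝ => U s ψ) (-(Complex.I • U t φ)) t := by
  have h0 := (hU.generator ψ φ).1 h
  have h1 : HasDerivAt (fun s : ℝ => U (s - t) ψ) (-(Complex.I • φ)) t := by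
    have : HasDerivAt (fun s : ℝ => U s ψ) (-(Complex.I • φ)) ((fun s => s - t) t) := by
      simpa using h0
    have h := HasDerivAt.scomp (h := fun s : ℝ => s - t) t this
      ((hasDerivAt_id' t).sub_const t)
    rwa [one_smul] at h
  have h2 := ((U t).restrictScalars ℝ).hasFDerivAt.comp_hasDerivAt t h1
  have e : (fun s : ℝ => U s ψ) = ((U t).restrictScalars ℝ) ∘ fun s : ℝ => U (s - t) ψ := by
    funext s
    have := congrArg (fun A => A ψ) (hU.map_add t (s - t))
    simpa using this
  rw [e]
  simpa using h2

theorem IsUnitaryGroupOf.map_graph {H : 𝓗 →ₗ.[ℂ] 𝓗} {U : ℝ → 𝓗 →L[ℂ] 𝓗}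
    (hU : IsUnitaryGroupOf H U) {ψ φ : 𝓗} (h : (ψ, φ) ∈ H.graph) (t : ℝ) :
    (U t ψ, U t φ) ∈ H.graph := by
  rw [hU.generator]
  have h2 := ((U t).restrictScalars ℝ).hasFDerivAt.comp_hasDerivAt 0 ((hU.generator ψ φ).1 h)
  have e : (fun s : ℝ => U s (U t ψ)) = ((U t).restrictScalars ℝ) ∘ fun s : ℝ => U s ψ := by
    funext s
    have h3 := congrArg (fun A => A ψ) (hU.map_add t s)
    have h4 := congrArg (fun A => A ψ) (hU.map_add s t)
    rw [add_comm t s] at h3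
    exact h4.symm.trans h3
  rw [e]
  simpa using h2

/-- The evolution of a state in the domain of `H` does not depend on the choice of the group. -/
theorem IsUnitaryGroupOf.unique {H : 𝓗 →ₗ.[ℂ] 𝓗} {U U' : ℝ → 𝓗 →L[ℂ] 𝓗}
    (hU : IsUnitaryGroupOf H U) (hU' : IsUnitaryGroupOf H U') {ψ : 𝓗} (h : ψ ∈ H.domain) (t : ℝ) :
    U t ψ = U' t ψ := by
  obtain ⟨φ, hφ⟩ : ∃ φ, (ψ, φ) ∈ H.graph := ⟨H ⟨ψ, h⟩, H.mem_graph ⟨ψ, h⟩⟩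
  let _ : InnerProductSpace ℝ 𝓗 := InnerProductSpace.complexToReal
  have key : ∀ x y : 𝓗, (x, y) ∈ H.graph → inner ℝ x (-(Complex.I • y)) = 0 := by
    intro x y hxy
    have h1 := ((hU.generator x y).1 hxy).norm_sq
    have h2 : (fun s : ℝ => ‖U s x‖ ^ 2) = fun _ => ‖x‖ ^ 2 := by
      funext s; rw [hU.norm_map]
    rw [h2] at h1
    have h3 := h1.unique (hasDerivAt_const (0 : ℝ) (‖x‖ ^ 2))
    simpa [hU.map_zero] using h3
  have hd : ∀ s : ℝ, HasDerivAt (fun s : ℝ => ‖U s ψ - U' s ψ‖ ^ 2) 0 s := by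
    intro s
    have h1 := ((hU.hasDerivAt hφ s).sub (hU'.hasDerivAt hφ s)).norm_sq
    have h2 := key _ _ (H.graph.sub_mem (hU.map_graph hφ s) (hU'.map_graph hφ s))
    have h3 : -(Complex.I • U s φ) - -(Complex.I • U' s φ)
        = -(Complex.I • (U s φ - U' s φ)) := by rw [smul_sub]; abel
    rw [h3] at h1
    have h4 : inner ℝ (U s ψ - U' s ψ) (-(Complex.I • (U s φ - U' s φ))) = 0 := h2
    simpa [h4] using h1
  have hc := is_const_of_deriv_eq_zero (fun s => (hd s).differentiableAt) (fun s => (hd s).deriv)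
    t 0
  simp only [hU.map_zero, hU'.map_zero, sub_self] at hc
  have : ‖U t ψ - U' t ψ‖ = 0 := by simpa using hc
  exact sub_eq_zero.1 (norm_eq_zero.1 this)

end Group

/-! ### Time-averaged moments and the growth exponent -/

section Moments

variable {ι : Type} [DecidableEq ι]

/-- `ψ(t, n)`, the `n`-th coordinate of `exp(-itH) δ_o`. -/
def amplitude (H : EllTwo ι →ₗ.[ℂ] EllTwo ι) (o : ι) (t : ℝ) (n : ι) : ℂ :=
  unitaryGroup H t (lp.single 2 o (1 : ℂ)) n

/-- `a(n, T) = (1/T) ∫₀^∞ exp(-2t/T) |ψ(t, n)|² dt`. -/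
def timeAverage (H : EllTwo ι →ₗ.[ℂ] EllTwo ι) (o : ι) (n : ι) (T : ℝ) : ℝ≥0∞ :=
  ENNReal.ofReal (1 / T) *
    ∫⁻ t in Set.Ioi (0 : ℝ), ENNReal.ofReal (Real.exp (-2 * t / T) * ‖amplitude H o t n‖ ^ 2)

/-- `⟨|X|^p⟩(T) = ∑ₙ |n|^p a(n, T)`, where `pos n` is the position `n` as an integer. -/
def moment (H : EllTwo ι →ₗ.[ℂ] EllTwo ι) (o : ι) (pos : ι → ℤ) (p T : ℝ) : ℝ≥0∞ :=
  ∑' n : ι, ENNReal.ofReal (|(pos n : ℝ)| ^ p) * timeAverage H o n T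

/-- `β⁻(p) = liminf_{T → ∞} log ⟨|X|^p⟩(T) / log T`, an extended real number. -/
def betaMinus (H : EllTwo ι →ₗ.[ℂ] EllTwo ι) (o : ι) (pos : ι → ℤ) (p : ℝ) : EReal :=
  liminf (fun T : ℝ => ENNReal.log (moment H o pos p T) / ((Real.log T : ℝ) : EReal)) atTop

end Moments

/-- `β⁻(p)` for the operator in `ℓ²(ℤ)` with potential `V` and the initial state `δ₁`. -/
def lineBetaMinus (V : ℤ → ℝ) (p : ℝ) : EReal :=
  betaMinus (lineOperator V) 1 (fun n : ℤ => n) p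

/-- `β⁻(p)` for the operator in `ℓ²({1, 2, …})` with potential `V` and the initial state `δ₁`. -/
def halfLineBetaMinus (V : ℕ+ → ℝ) (p : ℝ) : EReal :=
  betaMinus (halfLineOperator V) 1 (fun n : ℕ+ => (n : ℤ)) p

/-! ### Transfer matrices -/

/-- The one-step matrix `A(n, z)`. -/
def stepMatrix (V : ℤ → ℝ) (n : ℤ) (z : ℂ) : Matrix (Fin 2) (Fin 2) ℂ :=
  !![z - (V n : ℂ), -1; 1, 0]

/-- `A(m+k, z) A(m+k-1, z) ⋯ A(m+1, z)`. -/
def stepProd (V : ℤ → ℝ) (m : ℤ) (z : ℂ) : ℕ → Matrix (Fin 2) (Fin 2) ℂ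
  | 0 => 1
  | k + 1 => stepMatrix V (m + (k + 1 : ℕ)) z * stepProd V m z k

/-- The transfer matrix `T(n, m; z)`: `A(n, z) ⋯ A(m+1, z)` for `n > m`, the identity for
`n = m`, and `T(m, n; z)⁻¹` for `n < m`. -/
def transferMatrix (V : ℤ → ℝ) (n m : ℤ) (z : ℂ) : Matrix (Fin 2) (Fin 2) ℂ :=
  if m ≤ n then stepProd V m z (n - m).toNat else (stepProd V n z (m - n).toNat)⁻¹

/-- The transfer matrix `T(n, m; z)` of a potential on `{1, 2, …}`, for `n, m ≥ 1`; only the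
values of the potential at sites `> 1` enter, so the extension by `0` plays no role. -/
def halfLineTransferMatrix (V : ℕ+ → ℝ) (n m : ℕ+) (z : ℂ) : Matrix (Fin 2) (Fin 2) ℂ :=
  transferMatrix (Function.extend (fun k : ℕ+ => (k : ℤ)) V 0) n m z

end

/-! By Plancherel in time, a(n,T) is 1/T times the integral over ξ of |u(n)|², where u(n) is the
Fourier transform of the amplitude at n, damped by exp(-t/T). In n, u solves the stationary equation
at the complex energy z = E + i/T, E = -2πξ, with source -i at the site 1. If |E - E₀| ≤ T^(-1/θ),
the hypothesis bounds the transfer matrices at the real energy E for |n| ≤ T. Passing from E to z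
perturbs each step by O(1/T), so variation of constants and a discrete Grönwall estimate show that
(u(n+1), u(n)) shrinks by at most a constant factor over T sites (`norm_stateVec_one_le_right`,
`norm_stateVec_one_le_left`). The source keeps the data at the site 1 from being small, on the whole
line for at least one of the two directions. So about T/2 sites at distance of order T carry a sum
of |u|² of order T, for a set of ξ of measure of order T^(-1/θ), and the moment is at least of order
T^p · T⁻¹ · T · T^(-1/θ) (`le_betaMinus_of_window`).

All this needs the group to exist, since `unitaryGroup` is zero otherwise. Multiplication by the
possibly unbounded V generates explicit phases, and the hopping part L + L* is bounded and
symmetric; `IsUnitaryGroupOf.exists_of_bounded_perturbation` adds it by a Dyson series in the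
interaction picture. -/

noncomputable section

/-! ### Plancherel for the pointwise Fourier integral -/

section Plancherel
open scoped FourierTransform SchwartzMap

/-- The Fourier integral of an integrable and square integrable function represents its
`L²` Fourier transform. -/
theorem fourier_toLp_ae_eq {f : ℝ → ℂ} (h1 : Integrable f) (h2 : MemLp f 2) :
    (𝓕 (h2.toLp f) : Lp ℂ 2 (volume : Measure ℝ)) =ᵐ[volume] 𝓕 f := by
  have hloc : LocallyIntegrable (𝓕 f) := by
    refine Continuous.locallyIntegrable ?_
    exact VectorFourier.fourierIntegral_continuous Real.continuous_fourierChar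
      (by fun_prop) h1
  -- Both candidates are tested against smooth compactly supported g. The transform moves onto g by
  -- duality of tempered distributions on one side and by Fubini on the other.
  refine ae_eq_of_integral_contDiff_smul_eq
    ((Lp.memLp _).locallyIntegrable (by norm_num)) hloc ?_
  intro g hg hgc
  have hg₁ : HasCompactSupport (Complex.ofRealCLM ∘ g) := hgc.comp_left rfl
  have hg₂ : ContDiff ℝ (⊤ : ℕ∞) (Complex.ofRealCLM ∘ g) := by fun_prop
  set G : 𝓢(ℝ, ℂ) := hg₁.toSchwartzMap hg₂
  have hGx : ∀ x, G x = (g x : ℂ) := fun x => rfl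
  have key : ∫ x, g x • (𝓕 (h2.toLp f) : Lp ℂ 2 (volume : Measure ℝ)) x =
      ∫ x, g x • (𝓕 f : ℝ → ℂ) x := by
    calc ∫ x, g x • (𝓕 (h2.toLp f) : Lp ℂ 2 (volume : Measure ℝ)) x
        = ((𝓕 (h2.toLp f) : Lp ℂ 2 (volume : Measure ℝ)) : 𝓢'(ℝ, ℂ)) G := by
          rw [Lp.toTemperedDistribution_apply]; simp [hGx]
      _ = ∫ x, (𝓕 G) x • (h2.toLp f) x := by
          rw [← Lp.fourier_toTemperedDistribution_eq, TemperedDistribution.fourier_apply,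
            Lp.toTemperedDistribution_apply]
      _ = ∫ x, (𝓕 G) x • f x := by
          refine integral_congr_ae ?_
          filter_upwards [h2.coeFn_toLp] with x hx
          rw [hx]
      _ = ∫ x, G x • (𝓕 f : ℝ → ℂ) x := by
          have := VectorFourier.integral_fourierIntegral_smul_eq_flip (L := innerₗ ℝ)
            (μ := volume) (ν := volume) Real.continuous_fourierChar (by fun_prop) G.integrable h1
          rw [flip_innerₗ] at this
          exact this
      _ = ∫ x, g x • (𝓕 f : ℝ → ℂ) x := by simp [hGx]
  exact key

/-- **Plancherel's theorem** for integrable and square integrable functions. -/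
theorem lintegral_norm_sq_fourier {f : ℝ → ℂ} (h1 : Integrable f) (h2 : MemLp f 2) :
    ∫⁻ ξ, ENNReal.ofReal (‖𝓕 f ξ‖ ^ 2) = ∫⁻ t, ENNReal.ofReal (‖f t‖ ^ 2) := by
  have key : ∀ h : ℝ → ℂ, ∫⁻ t, ENNReal.ofReal (‖h t‖ ^ 2) = eLpNorm h 2 volume ^ 2 := by
    intro h
    rw [eLpNorm_eq_lintegral_rpow_enorm_toReal (by norm_num) (by norm_num)]
    simp only [ENNReal.toReal_ofNat, ENNReal.rpow_ofNat]
    rw [← ENNReal.rpow_natCast, ← ENNReal.rpow_mul]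
    norm_num
  rw [key, key, ← eLpNorm_congr_ae (fourier_toLp_ae_eq h1 h2), ← eLpNorm_congr_ae h2.coeFn_toLp]
  congr 1
  have := Lp.norm_fourier_eq (h2.toLp f)
  rw [Lp.norm_def, Lp.norm_def] at this
  exact (ENNReal.toReal_eq_toReal_iff' (Lp.memLp _).eLpNorm_ne_top (Lp.memLp _).eLpNorm_ne_top).1
    this
end Plancherel

/-! ### Linear evolution equations with bounded, strongly continuous coefficients -/

section Volterra
variable {E : Type} [NormedAddCommGroup E] [NormedSpace ℝ E]

/-- A family of uniformly bounded operators that is strongly continuous maps continuous curves to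
continuous curves. -/
theorem continuous_clm_apply_of_bounded {A : ℝ → E →L[ℝ] E} {b : ℝ} (hb : ∀ t, ‖A t‖ ≤ b)
    (hA : ∀ x, Continuous fun t => A t x) {f : ℝ → E} (hf : Continuous f) :
    Continuous fun t => A t (f t) := by
  rw [continuous_iff_continuousAt]
  intro t
  have h1 : Tendsto (fun s => A s (f t)) (nhds t) (nhds (A t (f t))) := (hA (f t)).tendsto t
  have h2 : Tendsto (fun s => A s (f s) - A s (f t)) (nhds t) (nhds 0) := by
    have h3 : Tendsto (fun s => b * ‖f s - f t‖) (nhds t) (nhds 0) := by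
      have : Continuous fun s => b * ‖f s - f t‖ := by fun_prop
      simpa using this.tendsto t
    refine squeeze_zero_norm (fun s => ?_) h3
    rw [← map_sub]
    exact (A s).le_of_opNorm_le (hb s) _
  have := h2.add h1
  simpa [ContinuousAt] using this

/-- The terms of the Dyson series. -/
def dysonTerm (A : ℝ → E →L[ℝ] E) (x : E) : ℕ → ℝ → E
  | 0 => fun _ => x
  | k + 1 => fun t => ∫ s in (0 : ℝ)..t, A s (dysonTerm A x k s)

theorem continuous_dysonTerm [CompleteSpace E] {A : ℝ → E →L[ℝ] E} {b : ℝ} (hb : ∀ t, ‖A t‖ ≤ b)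
    (hA : ∀ x, Continuous fun t => A t x) (x : E) (k : ℕ) : Continuous (dysonTerm A x k) := by
  induction k with
  | zero => exact continuous_const
  | succ k ih =>
    exact intervalIntegral.continuous_primitive
      (fun a c => (continuous_clm_apply_of_bounded hb hA ih).intervalIntegrable a c) 0

theorem hasDerivAt_dysonTerm [CompleteSpace E] {A : ℝ → E →L[ℝ] E} {b : ℝ} (hb : ∀ t, ‖A t‖ ≤ b)
    (hA : ∀ x, Continuous fun t => A t x) (x : E) (k : ℕ) (t : ℝ) :
    HasDerivAt (dysonTerm A x (k + 1)) (A t (dysonTerm A x k t)) t :=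
  (continuous_clm_apply_of_bounded hb hA
    (continuous_dysonTerm hb hA x k)).integral_hasStrictDerivAt 0 t |>.hasDerivAt

/-- Each integration of |s|^k contributes a factor |t|/(k+1), so the series is dominated by that of
exp(b|t|), for either sign of t. -/
theorem norm_dysonTerm_le {A : ℝ → E →L[ℝ] E} {b : ℝ} (hb : ∀ t, ‖A t‖ ≤ b)
    (x : E) (k : ℕ) (t : ℝ) :
    ‖dysonTerm A x k t‖ ≤ (b * |t|) ^ k / k.factorial * ‖x‖ := by
  have hb0 : 0 ≤ b := (norm_nonneg _).trans (hb 0)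
  induction k generalizing t with
  | zero => simp [dysonTerm]
  | succ k ih =>
    have hstep : ∀ s, ‖A s (dysonTerm A x k s)‖ ≤
        b ^ (k + 1) / k.factorial * ‖x‖ * |s| ^ k := by
      intro s
      calc _ ≤ b * ((b * |s|) ^ k / k.factorial * ‖x‖) :=
            (A s).le_of_opNorm_le_of_le (hb s) (ih s)
        _ = _ := by rw [mul_pow]; ring
    have hval : |∫ s in (0 : ℝ)..t, b ^ (k + 1) / k.factorial * ‖x‖ * |s| ^ k| =
        (b * |t|) ^ (k + 1) / (k + 1).factorial * ‖x‖ := by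
      rw [intervalIntegral.integral_const_mul, abs_mul]
      have : |∫ s in (0 : ℝ)..t, |s| ^ k| = |t| ^ (k + 1) / (k + 1) := by
        rcases le_total 0 t with ht | ht
        · have : ∫ s in (0 : ℝ)..t, |s| ^ k = ∫ s in (0 : ℝ)..t, s ^ k := by
            refine intervalIntegral.integral_congr fun s hs => ?_
            rw [Set.uIcc_of_le ht] at hs
            simp [abs_of_nonneg hs.1]
          rw [this, integral_pow]
          simp only [ne_eq, Nat.succ_ne_zero, not_false_eq_true, zero_pow, sub_zero]
          rw [abs_div, abs_pow]
          congr 1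
          exact abs_of_nonneg (by positivity)
        · have : ∫ s in (0 : ℝ)..t, |s| ^ k = ∫ s in (0 : ℝ)..t, (-s) ^ k := by
            refine intervalIntegral.integral_congr fun s hs => ?_
            rw [Set.uIcc_of_ge ht] at hs
            simp [abs_of_nonpos hs.2]
          rw [this, intervalIntegral.integral_comp_neg (fun s => s ^ k), integral_pow]
          simp only [ne_eq, Nat.succ_ne_zero, not_false_eq_true, zero_pow, neg_zero, zero_sub]
          rw [abs_div, abs_neg, abs_pow, abs_neg]
          congr 1
          exact abs_of_nonneg (by positivity)
      rw [this, abs_of_nonneg (by positivity), mul_pow, Nat.factorial_succ]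
      push_cast
      field_simp
    rw [← hval]
    exact intervalIntegral.norm_integral_le_abs_of_norm_le
      (ae_of_all _ hstep) (by
        have : Continuous fun s : ℝ => b ^ (k + 1) / k.factorial * ‖x‖ * |s| ^ k := by fun_prop
        exact this.intervalIntegrable _ _)

/-- Global solvability of `φ' = A(t) φ` for bounded, strongly continuous `A`. -/
theorem exists_hasDerivAt_clm [CompleteSpace E] {A : ℝ → E →L[ℝ] E} {b : ℝ} (hb : ∀ t, ‖A t‖ ≤ b)
    (hA : ∀ x, Continuous fun t => A t x) (x : E) :
    ∃ φ : ℝ → E, φ 0 = x ∧ ∀ t, HasDerivAt φ (A t (φ t)) t := by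
  have hb0 : 0 ≤ b := (norm_nonneg _).trans (hb 0)
  have hsum : ∀ t, Summable fun k => dysonTerm A x k t := fun t =>
    Summable.of_norm_bounded ((Real.summable_pow_div_factorial (b * |t|)).mul_right ‖x‖)
      fun k => norm_dysonTerm_le hb x k t
  have hzero : ∀ k, dysonTerm A x (k + 1) 0 = 0 := fun k => by simp [dysonTerm]
  refine ⟨fun t => ∑' k, dysonTerm A x k t, ?_, fun t => ?_⟩
  · show ∑' k, dysonTerm A x k 0 = x
    rw [(hsum 0).tsum_eq_zero_add]
    simp only [hzero, tsum_zero, add_zero]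
    rfl
  · set R : ℝ := |t| + 1 with hR
    have hmem : t ∈ Metric.ball (0 : ℝ) R := by simp [hR]
    -- Termwise differentiation on a ball around 0 containing t, where the bounds are uniform. The
    -- index is shifted because the derivative of term k + 1 is `A` applied to term k.
    have h := hasDerivAt_tsum_of_isPreconnected
      (u := fun k => b * ((b * R) ^ k / k.factorial * ‖x‖))
      (g := fun k => dysonTerm A x (k + 1)) (g' := fun k s => A s (dysonTerm A x k s))
      (((Real.summable_pow_div_factorial (b * R)).mul_right ‖x‖).mul_left b)
      Metric.isOpen_ball (convex_ball (0 : ℝ) R).isPreconnected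
      (fun k s _ => hasDerivAt_dysonTerm hb hA x k s)
      (fun k s hs => by
        refine (A s).le_of_opNorm_le_of_le (hb s) ((norm_dysonTerm_le hb x k s).trans ?_)
        have : |s| ≤ R := by simpa using (Metric.mem_ball.1 hs).le
        gcongr)
      hmem ((summable_nat_add_iff 1).2 (hsum t)) hmem
    have e : (fun s => ∑' k, dysonTerm A x k s) =
        fun s => x + ∑' k, dysonTerm A x (k + 1) s := by
      funext s
      rw [(hsum s).tsum_eq_zero_add]
      rfl
    rw [e]
    have h2 := h.const_add x
    convert h2 using 1
    have := congrFun e t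
    simp only at this ⊢
    rw [← this]
    exact (A t).map_tsum (hsum t)

/-- The field is Lipschitz with the same constant b at all times. Linearity and the group law are
later read off from this uniqueness. -/
theorem eq_of_hasDerivAt_clm {A : ℝ → E →L[ℝ] E} {b : ℝ} (hb : ∀ t, ‖A t‖ ≤ b)
    {φ ψ : ℝ → E} (hφ : ∀ t, HasDerivAt φ (A t (φ t)) t) (hψ : ∀ t, HasDerivAt ψ (A t (ψ t)) t)
    (h0 : φ 0 = ψ 0) : φ = ψ := by
  refine ODE_solution_unique_univ (v := fun t x => A t x) (s := fun _ => Set.univ)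
    (K := b.toNNReal) (t₀ := 0) (fun t => ?_)
    (fun t => ⟨hφ t, trivial⟩) (fun t => ⟨hψ t, trivial⟩) h0
  refine ((A t).lipschitz.weaken ?_).lipschitzOnWith
  rw [← NNReal.coe_le_coe]
  exact (hb t).trans (Real.le_coe_toNNReal b)
end Volterra

/-! ### Bounded symmetric perturbations of a generator -/

section Perturbation
variable {𝓗 : Type} [NormedAddCommGroup 𝓗] [InnerProductSpace ℂ 𝓗]

theorem IsUnitaryGroupOf.comp_apply {H : 𝓗 →ₗ.[ℂ] 𝓗} {U : ℝ → 𝓗 →L[ℂ] 𝓗}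
    (hU : IsUnitaryGroupOf H U) (s t : ℝ) (ψ : 𝓗) : U s (U t ψ) = U (s + t) ψ := by
  rw [hU.map_add]; rfl

theorem IsUnitaryGroupOf.neg_apply {H : 𝓗 →ₗ.[ℂ] 𝓗} {U : ℝ → 𝓗 →L[ℂ] 𝓗}
    (hU : IsUnitaryGroupOf H U) (t : ℝ) (ψ : 𝓗) : U (-t) (U t ψ) = ψ := by
  rw [hU.comp_apply]; simp [hU.map_zero]

theorem IsUnitaryGroupOf.apply_neg {H : 𝓗 →ₗ.[ℂ] 𝓗} {U : ℝ → 𝓗 →L[ℂ] 𝓗}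
    (hU : IsUnitaryGroupOf H U) (t : ℝ) (ψ : 𝓗) : U t (U (-t) ψ) = ψ := by
  rw [hU.comp_apply]; simp [hU.map_zero]

theorem IsUnitaryGroupOf.inner_map {H : 𝓗 →ₗ.[ℂ] 𝓗} {U : ℝ → 𝓗 →L[ℂ] 𝓗}
    (hU : IsUnitaryGroupOf H U) (t : ℝ) (ψ φ : 𝓗) : inner ℂ (U t ψ) (U t φ) = inner ℂ ψ φ :=
  (LinearIsometry.mk (U t).toLinearMap (hU.norm_map t)).inner_map_map ψ φ

/-- The interaction picture of `-iB` with respect to a unitary group `D`. -/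
def interaction (D : ℝ → 𝓗 →L[ℂ] 𝓗) (B : 𝓗 →L[ℂ] 𝓗) (t : ℝ) : 𝓗 →L[ℂ] 𝓗 :=
  -(Complex.I • (D (-t) ∘L B ∘L D t))

/-- A bounded symmetric perturbation of the generator of a unitary group is the generator of a
unitary group. -/
theorem IsUnitaryGroupOf.exists_of_bounded_perturbation [CompleteSpace 𝓗] {H₀ H : 𝓗 →ₗ.[ℂ] 𝓗}
    {D : ℝ → 𝓗 →L[ℂ] 𝓗}
    (hD : IsUnitaryGroupOf H₀ D) (B : 𝓗 →L[ℂ] 𝓗)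
    (hB : ∀ x y, inner ℂ (B x) y = inner ℂ x (B y))
    (hH : ∀ ψ φ, (ψ, φ) ∈ H.graph ↔ (ψ, φ - B ψ) ∈ H₀.graph) :
    ∃ U, IsUnitaryGroupOf H U := by
  -- Writing the wanted group as `D t` after `F · t` removes the unbounded part: `F` only has to
  -- solve an equation with the bounded coefficient -i D(-t) B D(t).
  set A : ℝ → 𝓗 →L[ℝ] 𝓗 := fun t => (interaction D B t).restrictScalars ℝ
  have hAx : ∀ t x, A t x = -(Complex.I • D (-t) (B (D t x))) := fun t x => rfl
  have hb : ∀ t, ‖A t‖ ≤ ‖B‖ := by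
    intro t
    refine (A t).opNorm_le_bound (norm_nonneg _) fun x => ?_
    rw [hAx, norm_neg, norm_smul, Complex.norm_I, one_mul, hD.norm_map, ← hD.norm_map t x]
    exact B.le_opNorm _
  have hDcurve : ∀ f : ℝ → 𝓗, Continuous f → Continuous fun t => D t (f t) := by
    intro f hf
    refine continuous_clm_apply_of_bounded (A := fun t => (D t).restrictScalars ℝ) (b := 1)
      (fun t => ?_) (fun x => hD.continuous x) hf
    exact ContinuousLinearMap.opNorm_le_bound _ zero_le_one fun x => by
      simp [hD.norm_map]
  have hA : ∀ x, Continuous fun t => A t x := by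
    intro x
    have h1 : Continuous fun t => B (D (-t) x) :=
      B.continuous.comp ((hD.continuous x).comp continuous_neg)
    have h2 : Continuous fun t => D (-t) (B (D t x)) := by
      simpa [Function.comp_def] using (hDcurve _ h1).comp continuous_neg
    have h3 : (fun t => A t x) = fun t : ℝ => -(Complex.I • D (-t) (B (D t x))) := rfl
    rw [h3]
    exact (h2.const_smul Complex.I).neg
  choose F hF0 hF using fun x => exists_hasDerivAt_clm hb hA x
  have huniq : ∀ (x : 𝓗) (g : ℝ → 𝓗), g 0 = x → (∀ t, HasDerivAt g (A t (g t)) t) → g = F x :=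
    fun x g h0 hg => eq_of_hasDerivAt_clm hb hg (hF x) (h0.trans (hF0 x).symm)
  have hFadd : ∀ x y t, F (x + y) t = F x t + F y t := by
    intro x y t
    refine (congrFun (huniq (x + y) (F x + F y) (by simp [hF0]) fun t => ?_) t).symm
    simpa using (hF x t).add (hF y t)
  have hFsmul : ∀ (c : ℂ) x t, F (c • x) t = c • F x t := by
    intro c x t
    refine (congrFun (huniq (c • x) (c • F x) (by simp [hF0]) fun t => ?_) t).symm
    have h := (hF x t).const_smul c
    have e : A t ((c • F x) t) = c • A t (F x t) := (interaction D B t).map_smul c (F x t)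
    rw [e]
    exact h
  have hFnorm : ∀ x t, ‖F x t‖ = ‖x‖ := by
    intro x t
    let _ : InnerProductSpace ℝ 𝓗 := InnerProductSpace.complexToReal
    have hd : ∀ s, HasDerivAt (fun s => ‖F x s‖ ^ 2) 0 s := by
      intro s
      have h1 := (hF x s).norm_sq
      -- Symmetry of B makes ⟨x, Bx⟩ real, so the factor -i leaves no real part and the norm is
      -- conserved.
      have h2 : inner ℝ (F x s) (A s (F x s)) = 0 := by
        have e : inner ℂ (F x s) (A s (F x s)) =
            -(Complex.I * inner ℂ (D s (F x s)) (B (D s (F x s)))) := by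
          rw [hAx, inner_neg_right, inner_smul_right, ← hD.inner_map s, hD.apply_neg]
        have h3 : (inner ℂ (D s (F x s)) (B (D s (F x s)))).im = 0 := by
          have h4 := inner_conj_symm (𝕜 := ℂ) (D s (F x s)) (B (D s (F x s)))
          rw [hB] at h4
          exact Complex.conj_eq_iff_im.1 h4
        show (inner ℂ (F x s) (A s (F x s))).re = 0
        rw [e]
        simp [h3]
      simpa [h2] using h1
    have hc := is_const_of_deriv_eq_zero (fun s => (hd s).differentiableAt) (fun s => (hd s).deriv)
      t 0
    simp only [hF0] at hc
    exact (sq_eq_sq₀ (norm_nonneg _) (norm_nonneg _)).1 hc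
  let G : ℝ → 𝓗 →L[ℂ] 𝓗 := fun t =>
    LinearMap.mkContinuous
      { toFun := fun x => F x t
        map_add' := fun x y => hFadd x y t
        map_smul' := fun c x => hFsmul c x t } 1 (fun x => by simp [hFnorm])
  have hG : ∀ t x, G t x = F x t := fun t x => rfl
  -- Since D(s) A(t+s) = A(t) D(s), both sides solve the same equation in t with the same value at t
  -- = 0. This gives the group law.
  have hshift : ∀ s t x, F (D s (F x s)) t = D s (F x (t + s)) := by
    intro s t x
    refine (congrFun (huniq _ (fun t => D s (F x (t + s))) (by simp) fun t => ?_) t).symm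
    have h1 : HasDerivAt (fun t => F x (t + s)) (A (t + s) (F x (t + s))) t :=
      (hF x (t + s)).comp_add_const t s
    have h2 := ((D s).restrictScalars ℝ).hasFDerivAt.comp_hasDerivAt t h1
    have e : A t (D s (F x (t + s))) = D s (A (t + s) (F x (t + s))) := by
      rw [hAx, hAx, map_neg, map_smul, hD.comp_apply, hD.comp_apply]
      congr 4
      ring
    rw [e]
    exact h2
  refine ⟨fun t => D t ∘L G t, ⟨?_, ?_, ?_, ?_, ?_⟩⟩
  · ext x
    simp [hG, hF0, hD.map_zero]
  · intro s t
    ext x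
    show D (s + t) (F x (s + t)) = D s (F (D t (F x t)) s)
    rw [hshift, hD.comp_apply]
  · intro t x
    show ‖D t (F x t)‖ = ‖x‖
    rw [hD.norm_map, hFnorm]
  · intro x
    exact hDcurve _ (continuous_iff_continuousAt.2 fun t => (hF x t).continuousAt)
  · intro ψ φ
    rw [hH, hD.generator]
    -- The increment `F ψ t - ψ` is differentiable at 0 for every ψ, and stays so under `D t`. Hence
    -- D(t)F(t) and D(t)ψ are differentiable together, so the two domains coincide exactly.
    have hdiff : HasDerivAt (fun t => D t (F ψ t - ψ)) (-(Complex.I • B ψ)) 0 := by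
      have h0 : HasDerivAt (F ψ) (-(Complex.I • B ψ)) 0 := by
        simpa [hAx, hF0, hD.map_zero] using hF ψ 0
      rw [hasDerivAt_iff_tendsto_slope] at h0 ⊢
      -- The difference quotient is completed by its limit at 0. The isometries `D t` are only
      -- strongly continuous, so the quotient is compared with that fixed limit vector.
      have hc : ContinuousAt (fun t => D t (Function.update (slope (F ψ) 0) 0
          (-(Complex.I • B ψ)) t)) 0 := by
        have h1 : ContinuousAt (Function.update (slope (F ψ) 0) 0 (-(Complex.I • B ψ))) 0 :=
          continuousAt_update_same.2 h0
        have h2 : Tendsto (fun t => D t (Function.update (slope (F ψ) 0) 0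
            (-(Complex.I • B ψ)) t - (-(Complex.I • B ψ)))) (nhds 0) (nhds 0) := by
          refine squeeze_zero_norm (a := fun t => ‖Function.update (slope (F ψ) 0) 0
            (-(Complex.I • B ψ)) t - (-(Complex.I • B ψ))‖) (fun t => ?_) ?_
          · rw [hD.norm_map]
          · have h3 := (h1.sub (continuousAt_const (y := -(Complex.I • B ψ)))).norm
            simpa [ContinuousAt] using h3
        have h4 := h2.add ((hD.continuous (-(Complex.I • B ψ))).tendsto 0)
        simpa [ContinuousAt, hD.map_zero] using h4
      have h5 : Tendsto (fun t => D t (Function.update (slope (F ψ) 0) 0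
          (-(Complex.I • B ψ)) t)) (nhdsWithin 0 {0}ᶜ) (nhds (-(Complex.I • B ψ))) := by
        have := hc.tendsto.mono_left (nhdsWithin_le_nhds (s := {0}ᶜ))
        simpa [hD.map_zero] using this
      refine h5.congr' ?_
      filter_upwards [self_mem_nhdsWithin] with t ht
      have ht' : t ≠ 0 := ht
      rw [Function.update_of_ne ht', slope, slope]
      simp only [sub_zero, vsub_eq_sub, hF0, sub_self, _root_.map_zero]
      exact ((D t).restrictScalars ℝ).map_smul t⁻¹ (F ψ t - ψ)
    have e : ∀ t, D t (F ψ t) = D t ψ + D t (F ψ t - ψ) := fun t => by rw [← _root_.map_add]; simp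
    constructor
    · intro h
      have h' := h.add hdiff
      have e2 : -(Complex.I • (φ - B ψ)) + -(Complex.I • B ψ) = -(Complex.I • φ) := by
        rw [smul_sub]; abel
      rw [e2] at h'
      exact h'.congr_of_eventuallyEq (Eventually.of_forall e)
    · intro h
      have h' := h.sub hdiff
      have e2 : -(Complex.I • φ) - -(Complex.I • B ψ) = -(Complex.I • (φ - B ψ)) := by
        rw [smul_sub]; abel
      rw [e2] at h'
      refine h'.congr_of_eventuallyEq (Eventually.of_forall fun t => ?_)
      show D t ψ = D t (F ψ t) - D t (F ψ t - ψ)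
      rw [← map_sub]; simp
end Perturbation

/-! ### Multiplication operators and their phase groups -/

section Multiplication
variable {ι : Type}

theorem mem_graph_ellTwoOperator {τ : (ι → ℂ) →ₗ[ℂ] (ι → ℂ)} {ψ φ : EllTwo ι} :
    (ψ, φ) ∈ (ellTwoOperator τ).graph ↔ (φ : ι → ℂ) = τ ψ := by
  rw [LinearPMap.mem_graph_iff]
  constructor
  · rintro ⟨y, hy, rfl⟩
    simp only at hy
    subst hy
    rfl
  · intro h
    refine ⟨⟨ψ, ?_⟩, rfl, ?_⟩
    · show Memℓp (τ ψ) 2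
      rw [← h]
      exact lp.memℓp φ
    · exact lp.ext h.symm

theorem norm_sq_ellTwo (f : EllTwo ι) : ‖f‖ ^ 2 = ∑' n, ‖f n‖ ^ 2 := by
  have := lp.norm_rpow_eq_tsum (p := 2) (by norm_num) f
  simpa using this

theorem summable_sq_ellTwo (f : EllTwo ι) : Summable fun n => ‖f n‖ ^ 2 := by
  have := (lp.memℓp f).summable (by norm_num)
  simpa using this

/-- Dominated convergence for the sum of squares; it yields both strong continuity and the
derivative of the phase group. -/
theorem tendsto_ellTwo_of_dominated {α : Type} {l : Filter α} {F : α → EllTwo ι} {f g : EllTwo ι}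
    (hb : ∀ᶠ a in l, ∀ n, ‖F a n - f n‖ ≤ ‖g n‖)
    (h : ∀ n, Tendsto (fun a => F a n) l (nhds (f n))) : Tendsto F l (nhds f) := by
  rw [tendsto_iff_norm_sub_tendsto_zero]
  have h1 : Tendsto (fun a => ‖F a - f‖ ^ 2) l (nhds 0) := by
    have h2 := tendsto_tsum_of_dominated_convergence (𝓕 := l)
      (f := fun a n => ‖(F a - f) n‖ ^ 2) (g := fun _ => (0 : ℝ)) (summable_sq_ellTwo g)
      (fun n => by
        have := ((h n).sub_const (f n)).norm.pow 2
        simpa using this)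
      (by
        filter_upwards [hb] with a ha n
        rw [Real.norm_of_nonneg (by positivity)]
        exact pow_le_pow_left₀ (norm_nonneg _) (ha n) 2)
    simpa only [norm_sq_ellTwo, tsum_zero] using h2
  have h2 := (Real.continuous_sqrt.tendsto 0).comp h1
  simpa [Function.comp_def, Real.sqrt_sq (norm_nonneg _)] using h2

/-- Multiplication by a real function. -/
def mulExpr (V : ι → ℝ) : (ι → ℂ) →ₗ[ℂ] (ι → ℂ) where
  toFun u n := (V n : ℂ) * u n
  map_add' u v := by ext n; simp only [Pi.add_apply]; ring
  map_smul' c u := by ext n; simp only [Pi.smul_apply, smul_eq_mul, RingHom.id_apply]; ring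

theorem norm_phase (x : ℝ) : ‖Complex.exp (Complex.I * x)‖ = 1 := by
  rw [mul_comm]; exact Complex.norm_exp_ofReal_mul_I x

/-- The unitary group generated by a multiplication operator. -/
def phaseGroup (V : ι → ℝ) (t : ℝ) : EllTwo ι →L[ℂ] EllTwo ι :=
  LinearMap.mkContinuous
    { toFun := fun f => ⟨fun n => Complex.exp (Complex.I * ((-t * V n : ℝ) : ℂ)) * f n,
        (lp.memℓp f).mono' fun n => by rw [norm_mul, norm_phase, one_mul]⟩
      map_add' := fun f g => by
        ext n
        exact mul_add _ (f n) (g n)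
      map_smul' := fun c f => by
        ext n
        exact mul_left_comm _ c (f n) } 1
    fun f => by
      rw [one_mul]
      refine le_of_eq ?_
      refine (sq_eq_sq₀ (norm_nonneg _) (norm_nonneg _)).1 ?_
      rw [norm_sq_ellTwo, norm_sq_ellTwo]
      refine tsum_congr fun n => ?_
      simp only [LinearMap.coe_mk, AddHom.coe_mk]
      rw [norm_mul, norm_phase, one_mul]

theorem phaseGroup_apply (V : ι → ℝ) (t : ℝ) (f : EllTwo ι) (n : ι) :
    phaseGroup V t f n = Complex.exp (Complex.I * ((-t * V n : ℝ) : ℂ)) * f n := rfl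

/-- On the natural domain, |exp(ix) - 1| ≤ |x| dominates the difference quotients by |Vψ|, which is
square summable. Conversely, a derivative in ℓ² is identified coordinate by coordinate. -/
theorem isUnitaryGroupOf_phaseGroup (V : ι → ℝ) :
    IsUnitaryGroupOf (ellTwoOperator (mulExpr V)) (phaseGroup V) := by
  refine ⟨?_, ?_, ?_, ?_, ?_⟩
  · ext f n
    simp [phaseGroup_apply]
  · intro s t
    ext f n
    simp only [ContinuousLinearMap.coe_comp, Function.comp_apply, phaseGroup_apply]
    rw [← mul_assoc, ← Complex.exp_add]
    congr 2
    push_cast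
    ring
  · intro t f
    refine (sq_eq_sq₀ (norm_nonneg _) (norm_nonneg _)).1 ?_
    rw [norm_sq_ellTwo, norm_sq_ellTwo]
    refine tsum_congr fun n => ?_
    rw [phaseGroup_apply, norm_mul, norm_phase, one_mul]
  · intro f
    rw [continuous_iff_continuousAt]
    intro t
    refine tendsto_ellTwo_of_dominated (g := (2 : ℂ) • f) (Eventually.of_forall fun s n => ?_)
      fun n => ?_
    · rw [phaseGroup_apply, phaseGroup_apply, lp.coeFn_smul, Pi.smul_apply, norm_smul]
      refine (norm_sub_le _ _).trans ?_
      rw [norm_mul, norm_phase, norm_mul, norm_phase]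
      norm_num
      linarith
    · simp only [phaseGroup_apply]
      refine Continuous.tendsto ?_ t
      fun_prop
  · intro ψ φ
    rw [mem_graph_ellTwoOperator]
    have hcoord : ∀ n, HasDerivAt (fun t : ℝ => phaseGroup V t ψ n)
        (-(Complex.I * (V n * ψ n))) 0 := by
      intro n
      simp only [phaseGroup_apply]
      have h1 : HasDerivAt (fun t : ℝ => Complex.I * ((-t * V n : ℝ) : ℂ))
          (Complex.I * ((-1 * V n : ℝ) : ℂ)) 0 :=
        (((hasDerivAt_id' (0 : ℝ)).neg.mul_const (V n)).ofReal_comp).const_mul Complex.I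
      have h2 := (h1.cexp).mul_const (ψ n)
      refine h2.congr_deriv ?_
      push_cast
      simp only [neg_zero, zero_mul, mul_zero, Complex.exp_zero]
      ring
    constructor
    · intro h
      refine hasDerivAt_iff_tendsto_slope.2 ?_
      refine tendsto_ellTwo_of_dominated (g := (2 : ℂ) • φ) ?_ fun n => ?_
      · filter_upwards [self_mem_nhdsWithin] with t ht n
        have ht' : t ≠ 0 := ht
        have e1 : slope (fun t => phaseGroup V t ψ) 0 t n =
            (t : ℂ)⁻¹ * ((Complex.exp (Complex.I * ((-t * V n : ℝ) : ℂ)) - 1) * ψ n) := by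
          show (((t - 0)⁻¹ : ℝ) : ℂ) * (phaseGroup V t ψ n - phaseGroup V 0 ψ n) = _
          rw [phaseGroup_apply, phaseGroup_apply]
          push_cast
          simp only [sub_zero, neg_zero, zero_mul, mul_zero, Complex.exp_zero]
          ring
        have e2 : φ n = V n * ψ n := congrFun h n
        rw [e1, lp.coeFn_smul, Pi.smul_apply, norm_smul, lp.coeFn_neg, Pi.neg_apply,
          lp.coeFn_smul, Pi.smul_apply, e2]
        refine (norm_sub_le _ _).trans ?_
        have h3 := Real.norm_exp_I_mul_ofReal_sub_one_le (x := -t * V n)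
        have h4 : ‖(t : ℂ)⁻¹ * ((Complex.exp (Complex.I * ((-t * V n : ℝ) : ℂ)) - 1) * ψ n)‖ ≤
            |V n| * ‖ψ n‖ := by
          rw [norm_mul, norm_mul, norm_inv, Complex.norm_real]
          calc _ ≤ ‖t‖⁻¹ * (‖-t * V n‖ * ‖ψ n‖) := by gcongr
            _ = _ := by
              rw [norm_mul, norm_neg]
              have : ‖t‖ ≠ 0 := norm_ne_zero_iff.2 ht'
              field_simp
              simp [mul_comm]
        refine (add_le_add_left h4 _).trans (le_of_eq ?_)
        rw [norm_neg, norm_smul, Complex.norm_I, norm_mul, Complex.norm_real]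
        norm_num
        ring
      · have h1 := hasDerivAt_iff_tendsto_slope.1 (hcoord n)
        have e2 : φ n = V n * ψ n := congrFun h n
        have e3 : (-(Complex.I • φ) : EllTwo ι) n = -(Complex.I * (V n * ψ n)) := by
          rw [lp.coeFn_neg, Pi.neg_apply, lp.coeFn_smul, Pi.smul_apply, e2, smul_eq_mul]
        rw [e3]
        exact h1
    · intro h
      funext n
      have h1 : HasDerivAt (fun t : ℝ => phaseGroup V t ψ n) ((-(Complex.I • φ) : EllTwo ι) n) 0 :=
        ((lp.evalCLM ℂ (fun _ : ι => ℂ) 2 n).restrictScalars ℝ).hasFDerivAt.comp_hasDerivAt 0 h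
      have h2 := h1.unique (hcoord n)
      rw [lp.coeFn_neg, Pi.neg_apply, lp.coeFn_smul, Pi.smul_apply, smul_eq_mul, neg_inj] at h2
      exact mul_left_cancel₀ Complex.I_ne_zero h2
end Multiplication

/-! ### Shifts, their adjoints and existence of the Schrödinger group -/

section Shift
variable {ι : Type}

/-- The pullback of square summable families along an injective map. -/
def pullback (e : ι → ι) (he : Function.Injective e) : EllTwo ι →L[ℂ] EllTwo ι :=
  LinearMap.mkContinuous
    { toFun := fun f => ⟨fun n => f (e n), by
        have := (summable_sq_ellTwo f).comp_injective he
        exact memℓp_gen (by simpa [Function.comp_def] using this)⟩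
      map_add' := fun f g => by ext n; rfl
      map_smul' := fun c f => by ext n; rfl } 1
    fun f => by
      rw [one_mul]
      refine (sq_le_sq₀ (norm_nonneg _) (norm_nonneg _)).1 ?_
      rw [norm_sq_ellTwo, norm_sq_ellTwo]
      exact tsum_comp_le_tsum_of_inj (summable_sq_ellTwo f) (fun n => by positivity) he

theorem pullback_apply (e : ι → ι) (he : Function.Injective e) (f : EllTwo ι) (n : ι) :
    pullback e he f n = f (e n) := rfl

theorem adjoint_pullback_apply [DecidableEq ι] (e : ι → ι) (he : Function.Injective e)
    (f : EllTwo ι) (n : ι) :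
    (pullback e he).adjoint f (e n) = f n := by
  have h1 := lp.inner_single_left (𝕜 := ℂ) (e n) (1 : ℂ) ((pullback e he).adjoint f)
  have h2 := lp.inner_single_left (𝕜 := ℂ) n (1 : ℂ) f
  rw [ContinuousLinearMap.adjoint_inner_right] at h1
  have e1 : pullback e he (lp.single 2 (e n) (1 : ℂ)) = lp.single 2 n (1 : ℂ) := by
    ext m
    rw [pullback_apply, lp.single_apply, lp.single_apply]
    simp [Pi.single_apply, he.eq_iff]
  rw [e1, h2] at h1
  simpa using h1.symm

theorem adjoint_pullback_apply_of_notMem [DecidableEq ι] (e : ι → ι) (he : Function.Injective e)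
    (f : EllTwo ι) (n : ι) (hn : ∀ m, e m ≠ n) :
    (pullback e he).adjoint f n = 0 := by
  have h1 := lp.inner_single_left (𝕜 := ℂ) n (1 : ℂ) ((pullback e he).adjoint f)
  rw [ContinuousLinearMap.adjoint_inner_right] at h1
  have e1 : pullback e he (lp.single 2 n (1 : ℂ)) = 0 := by
    ext m
    rw [pullback_apply, lp.single_apply]
    simp [hn m]
  rw [e1] at h1
  simpa using h1.symm

/-- The operator `L + L* + V` with natural domain generates a unitary group, where `L` is the
pullback along an injective map. -/
theorem exists_isUnitaryGroupOf_of_pullback [DecidableEq ι] {e : ι → ι}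
    (he : Function.Injective e) (V : ι → ℝ) {τ : (ι → ℂ) →ₗ[ℂ] (ι → ℂ)}
    (hτ : ∀ (f : EllTwo ι) n,
      τ f n = (pullback e he).adjoint f n + pullback e he f n + V n * f n) :
    ∃ U, IsUnitaryGroupOf (ellTwoOperator τ) U := by
  refine (isUnitaryGroupOf_phaseGroup V).exists_of_bounded_perturbation
    ((pullback e he).adjoint + pullback e he) (fun x y => ?_) fun ψ φ => ?_
  · rw [_root_.add_apply, _root_.add_apply, inner_add_left,
      inner_add_right, ContinuousLinearMap.adjoint_inner_left,
      ContinuousLinearMap.adjoint_inner_right, add_comm]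
  · rw [mem_graph_ellTwoOperator, mem_graph_ellTwoOperator]
    have h1 : τ ψ = fun n => (pullback e he).adjoint ψ n + pullback e he ψ n + V n * ψ n :=
      funext (hτ ψ)
    rw [h1, lp.coeFn_sub, _root_.add_apply, lp.coeFn_add, sub_eq_iff_eq_add']
    rfl

/-- Needed to differentiate the evolution of the initial state in time; on it V acts as the scalar
V(o). -/
theorem single_mem_domain_of_pullback [DecidableEq ι] {e : ι → ι}
    (he : Function.Injective e) (V : ι → ℝ) {τ : (ι → ℂ) →ₗ[ℂ] (ι → ℂ)}
    (hτ : ∀ (f : EllTwo ι) n,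
      τ f n = (pullback e he).adjoint f n + pullback e he f n + V n * f n) (o : ι) :
    (lp.single 2 o (1 : ℂ) : EllTwo ι) ∈ (ellTwoOperator τ).domain := by
  set δ : EllTwo ι := lp.single 2 o (1 : ℂ) with hδ
  show Memℓp (τ δ) 2
  have h1 : τ δ = ((pullback e he).adjoint δ + pullback e he δ + (V o : ℂ) • δ : EllTwo ι) := by
    funext n
    rw [hτ, lp.coeFn_add, Pi.add_apply, lp.coeFn_add, Pi.add_apply, lp.coeFn_smul, Pi.smul_apply,
      smul_eq_mul]
    congr 1
    by_cases h : n = o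
    · rw [h]
    · simp [hδ, lp.single_apply, h]
  rw [h1]
  exact lp.memℓp _
end Shift

/-! ### Transfer matrices and lower bounds for solutions -/

section Transfer
open Matrix

theorem norm_entry_le_l2_opNorm (M : Matrix (Fin 2) (Fin 2) ℂ) (i j : Fin 2) : ‖M i j‖ ≤ ‖M‖ := by
  have h1 := M.l2_opNorm_mulVec (EuclideanSpace.single j (1 : ℂ))
  have h2 := PiLp.norm_apply_le (WithLp.toLp 2 (M *ᵥ (EuclideanSpace.single j (1 : ℂ)).ofLp)) i
  simp at h1 h2
  exact h2.trans h1

/-- Vectors carry the sup norm here and matrices the Euclidean operator norm; entry bounds mediate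
between the two and pass easily to inverses. -/
theorem norm_mulVec_le_of_entries {M : Matrix (Fin 2) (Fin 2) ℂ} {C : ℝ}
    (hM : ∀ i j, ‖M i j‖ ≤ C) (v : Fin 2 → ℂ) : ‖M *ᵥ v‖ ≤ 2 * C * ‖v‖ := by
  have hC : 0 ≤ C := (norm_nonneg _).trans (hM 0 0)
  rw [pi_norm_le_iff_of_nonneg (by positivity)]
  intro i
  have : (M *ᵥ v) i = M i 0 * v 0 + M i 1 * v 1 := by
    simp [mulVec, dotProduct, Fin.sum_univ_two]
  rw [this]
  calc ‖M i 0 * v 0 + M i 1 * v 1‖ ≤ ‖M i 0‖ * ‖v 0‖ + ‖M i 1‖ * ‖v 1‖ := by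
        refine (norm_add_le _ _).trans ?_
        rw [norm_mul, norm_mul]
    _ ≤ C * ‖v‖ + C * ‖v‖ := by
        gcongr
        · exact hM i 0
        · exact norm_le_pi_norm v 0
        · exact hM i 1
        · exact norm_le_pi_norm v 1
    _ = 2 * C * ‖v‖ := by ring

theorem det_stepMatrix (V : ℤ → ℝ) (n : ℤ) (z : ℂ) : (stepMatrix V n z).det = 1 := by
  simp [stepMatrix, det_fin_two]

theorem det_stepProd (V : ℤ → ℝ) (m : ℤ) (z : ℂ) (k : ℕ) : (stepProd V m z k).det = 1 := by
  induction k with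
  | zero => simp [stepProd]
  | succ k ih => rw [stepProd, det_mul, det_stepMatrix, ih, one_mul]

theorem det_transferMatrix (V : ℤ → ℝ) (n m : ℤ) (z : ℂ) : (transferMatrix V n m z).det = 1 := by
  unfold transferMatrix
  split_ifs
  · exact det_stepProd _ _ _ _
  · rw [det_nonsing_inv, det_stepProd, Ring.inverse_one]

theorem stepProd_succ_right (V : ℤ → ℝ) (m : ℤ) (z : ℂ) (k : ℕ) :
    stepProd V m z (k + 1) = stepProd V (m + 1) z k * stepMatrix V (m + 1) z := by
  induction k with
  | zero => simp [stepProd]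
  | succ k ih =>
    rw [stepProd, ih, ← Matrix.mul_assoc]
    congr 1
    rw [stepProd]
    congr 2
    push_cast
    ring

/-- One recursion valid on both sides of m, so that the inverse in the definition needs no separate
treatment afterwards. -/
theorem transferMatrix_eq_stepMatrix_mul (V : ℤ → ℝ) (n m : ℤ) (z : ℂ) :
    transferMatrix V n m z = stepMatrix V n z * transferMatrix V (n - 1) m z := by
  rcases lt_trichotomy n m with h | h | h
  · obtain ⟨k, hk⟩ : ∃ k : ℕ, m - n = k := ⟨(m - n).toNat, by omega⟩
    have h1 : (m - (n - 1)).toNat = k + 1 := by omega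
    have h2 : (m - n).toNat = k := by omega
    rw [transferMatrix, transferMatrix, if_neg (by omega), if_neg (by omega), h1, h2,
      stepProd_succ_right, sub_add_cancel, Matrix.mul_inv_rev, ← Matrix.mul_assoc,
      mul_nonsing_inv _ (by rw [det_stepMatrix]; exact isUnit_one), one_mul]
  · subst h
    have h1 : (n - (n - 1)).toNat = 1 := by omega
    rw [transferMatrix, transferMatrix, if_pos le_rfl, if_neg (by omega), h1,
      stepProd_succ_right, sub_add_cancel]
    simp only [sub_self, Int.toNat_zero, stepProd, one_mul]
    rw [mul_nonsing_inv _ (by rw [det_stepMatrix]; exact isUnit_one)]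
  · obtain ⟨k, hk⟩ : ∃ k : ℕ, n - 1 - m = k := ⟨(n - 1 - m).toNat, by omega⟩
    have h1 : (n - m).toNat = k + 1 := by omega
    have h2 : (n - 1 - m).toNat = k := by omega
    rw [transferMatrix, transferMatrix, if_pos (by omega), if_pos (by omega), h1, h2, stepProd]
    congr 2
    push_cast
    omega

/-- Discrete Grönwall run backwards: the increment is measured by the new value, so ‖y k‖ ≤ (1 +
κ)‖y (k+1)‖ and the far end controls the near end. -/
theorem norm_le_exp_mul_of_norm_sub_le {F : Type} [NormedAddCommGroup F] {y : ℕ → F} {κ : ℝ}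
    {m : ℕ} (h : ∀ k < m, ‖y (k + 1) - y k‖ ≤ κ * ‖y (k + 1)‖) :
    ‖y 0‖ ≤ Real.exp (κ * m) * ‖y m‖ := by
  induction m with
  | zero => simp
  | succ m ih =>
    have h1 := ih fun k hk => h k (by omega)
    have h2 := h m (by omega)
    have h3 : ‖y m‖ ≤ (κ + 1) * ‖y (m + 1)‖ := by
      have := norm_sub_le (y (m + 1)) (y (m + 1) - y m)
      rw [sub_sub_cancel] at this
      linarith
    calc ‖y 0‖ ≤ Real.exp (κ * m) * ((κ + 1) * ‖y (m + 1)‖) := h1.trans (by gcongr)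
      _ ≤ Real.exp (κ * m) * (Real.exp κ * ‖y (m + 1)‖) := by
        gcongr
        exact Real.add_one_le_exp κ
      _ = Real.exp (κ * (m + 1 : ℕ)) * ‖y (m + 1)‖ := by
        rw [← mul_assoc, ← Real.exp_add]
        congr 2
        push_cast
        ring

/-- The vector `(u(n+1), u(n))`. -/
def stateVec (u : ℤ → ℂ) (n : ℤ) : Fin 2 → ℂ := ![u (n + 1), u n]

theorem norm_stateVec (u : ℤ → ℂ) (n : ℤ) : ‖stateVec u n‖ = max ‖u (n + 1)‖ ‖u n‖ := by
  apply le_antisymm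
  · rw [pi_norm_le_iff_of_nonneg (le_max_of_le_left (norm_nonneg _))]
    intro i
    fin_cases i <;> simp [stateVec]
  · exact max_le (norm_le_pi_norm (stateVec u n) 0) (norm_le_pi_norm (stateVec u n) 1)

section Reduced
variable (V : ℤ → ℝ) (E : ℂ) (u : ℤ → ℂ)

/-- The vector `(u(n+1), u(n))` transported back to the site `1` at the energy `E`. -/
def reducedVec (n : ℤ) : Fin 2 → ℂ := (transferMatrix V n 1 E)⁻¹ *ᵥ stateVec u n

/-- The determinant is 1, so the inverse is the adjugate: the same entries up to place and sign. -/
theorem norm_inv_transferMatrix_entry_le {n : ℤ} {C : ℝ}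
    (h : ∀ i j, ‖transferMatrix V n 1 E i j‖ ≤ C) (i j : Fin 2) :
    ‖(transferMatrix V n 1 E)⁻¹ i j‖ ≤ C := by
  rw [inv_def, det_transferMatrix, Ring.inverse_one, one_smul, adjugate_fin_two]
  fin_cases i <;> fin_cases j <;> simp [h]

theorem norm_reducedVec_le {n : ℤ} {C : ℝ} (h : ∀ i j, ‖transferMatrix V n 1 E i j‖ ≤ C) :
    ‖reducedVec V E u n‖ ≤ 2 * C * ‖stateVec u n‖ :=
  norm_mulVec_le_of_entries (norm_inv_transferMatrix_entry_le V E h) _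

theorem norm_stateVec_le {n : ℤ} {C : ℝ} (h : ∀ i j, ‖transferMatrix V n 1 E i j‖ ≤ C) :
    ‖stateVec u n‖ ≤ 2 * C * ‖reducedVec V E u n‖ := by
  have e : stateVec u n = transferMatrix V n 1 E *ᵥ reducedVec V E u n := by
    rw [reducedVec, mulVec_mulVec,
      mul_nonsing_inv _ (by rw [det_transferMatrix]; exact isUnit_one), one_mulVec]
  rw [e]
  exact norm_mulVec_le_of_entries h _

/-- Variation of constants: for z = E the reduced vector would not depend on n, and its increment is
the defect (z - E)u(n) transported back to the site 1. -/
theorem reducedVec_sub {z : ℂ} {n : ℤ} (hu : u (n + 1) + u (n - 1) = (z - V n) * u n) :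
    reducedVec V E u n - reducedVec V E u (n - 1) =
      (transferMatrix V n 1 E)⁻¹ *ᵥ ![(z - E) * u n, 0] := by
  have h1 : reducedVec V E u (n - 1) =
      (transferMatrix V n 1 E)⁻¹ *ᵥ (stepMatrix V n E *ᵥ stateVec u (n - 1)) := by
    rw [reducedVec, transferMatrix_eq_stepMatrix_mul V n, mulVec_mulVec, Matrix.mul_inv_rev,
      Matrix.mul_assoc, nonsing_inv_mul _ (by rw [det_stepMatrix]; exact isUnit_one), mul_one]
  rw [h1, reducedVec, ← mulVec_sub]
  congr 1
  have h2 : u (n + 1) = (z - V n) * u n - u (n - 1) := by rw [← hu]; ring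
  ext i
  fin_cases i
  · simp [stateVec, stepMatrix, h2]
    ring
  · simp [stateVec, stepMatrix]

theorem norm_reducedVec_sub_le {z : ℂ} {n : ℤ} (hu : u (n + 1) + u (n - 1) = (z - V n) * u n)
    {C : ℝ} (h : ∀ i j, ‖transferMatrix V n 1 E i j‖ ≤ C) :
    ‖reducedVec V E u n - reducedVec V E u (n - 1)‖ ≤ 2 * C * (‖z - E‖ * ‖u n‖) := by
  rw [reducedVec_sub V E u hu]
  refine (norm_mulVec_le_of_entries (norm_inv_transferMatrix_entry_le V E h) _).trans ?_
  have hC : 0 ≤ C := (norm_nonneg _).trans (h 0 0)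
  gcongr
  rw [pi_norm_le_iff_of_nonneg (by positivity)]
  intro i
  fin_cases i
  · simp
  · simp
    positivity

theorem reducedVec_one : reducedVec V E u 1 = stateVec u 1 := by
  simp [reducedVec, transferMatrix, stepProd]

/-- Lower bound for solutions to the right of the site `1`. -/
theorem norm_stateVec_one_le_right {z : ℂ} {C : ℝ} {N : ℕ} (hz : ‖z - E‖ * N ≤ 2)
    (hT : ∀ n : ℤ, 1 ≤ n → n ≤ N → ∀ i j, ‖transferMatrix V n 1 E i j‖ ≤ C)
    (hu : ∀ n : ℤ, 2 ≤ n → n ≤ N → u (n + 1) + u (n - 1) = (z - V n) * u n)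
    {n : ℤ} (hn : 1 ≤ n) (hnN : n ≤ N) :
    ‖stateVec u 1‖ ≤ Real.exp (8 * C ^ 2) * (2 * C) * ‖stateVec u n‖ := by
  have hC : 0 ≤ C := (norm_nonneg _).trans (hT n hn hnN 0 0)
  obtain ⟨m, rfl⟩ : ∃ m : ℕ, n = m + 1 := ⟨(n - 1).toNat, by omega⟩
  -- One factor 2C in κ comes from the inverse transfer matrix in the increment, the other from
  -- bounding u by the reduced vector. As ‖z - E‖N ≤ 2, the total exponent is at most 8C².
  have h := norm_le_exp_mul_of_norm_sub_le (y := fun k : ℕ => reducedVec V E u (k + 1))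
    (κ := 4 * C ^ 2 * ‖z - E‖) (m := m) (fun k hk => by
      have hT' := hT (k + 2) (by omega) (by omega)
      have h1 := norm_reducedVec_sub_le V E u (hu (k + 2) (by omega) (by omega)) hT'
      have e : (k : ℤ) + 2 - 1 = k + 1 := by ring
      have e' : ((k + 1 : ℕ) : ℤ) + 1 = k + 2 := by push_cast; ring
      rw [e] at h1
      simp only [e']
      refine h1.trans ?_
      have h2 := norm_stateVec_le V E u hT'
      have h3 : ‖u (k + 2)‖ ≤ ‖stateVec u (k + 2)‖ := by
        rw [norm_stateVec]; exact le_max_right _ _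
      calc 2 * C * (‖z - E‖ * ‖u (k + 2)‖)
          ≤ 2 * C * (‖z - E‖ * (2 * C * ‖reducedVec V E u (k + 2)‖)) := by
            gcongr; exact h3.trans h2
        _ = _ := by ring)
  simp only [Nat.cast_zero, zero_add, reducedVec_one] at h
  have h4 := norm_reducedVec_le V E u (hT (m + 1) hn hnN)
  have h5 : Real.exp (4 * C ^ 2 * ‖z - E‖ * m) ≤ Real.exp (8 * C ^ 2) := by
    rw [Real.exp_le_exp]
    have h6 : (m : ℝ) ≤ N := by exact_mod_cast (by omega : m ≤ N)
    have h7 : ‖z - E‖ * m ≤ 2 := (by gcongr : ‖z - E‖ * m ≤ ‖z - E‖ * N).trans hz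
    calc _ = 4 * C ^ 2 * (‖z - E‖ * m) := by ring
      _ ≤ 4 * C ^ 2 * 2 := by gcongr
      _ = _ := by ring
  calc _ ≤ _ := h
    _ ≤ Real.exp (8 * C ^ 2) * (2 * C * ‖stateVec u (m + 1)‖) := by gcongr
    _ = _ := by ring

/-- Lower bound for solutions to the left of the site `1`. -/
theorem norm_stateVec_one_le_left {z : ℂ} {C : ℝ} {N : ℕ} (hz : ‖z - E‖ * (N + 1) ≤ 2)
    (hT : ∀ n : ℤ, -N ≤ n → n ≤ 1 → ∀ i j, ‖transferMatrix V n 1 E i j‖ ≤ C)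
    (hu : ∀ n : ℤ, -N < n → n ≤ 1 → u (n + 1) + u (n - 1) = (z - V n) * u n)
    {n : ℤ} (hn : -N ≤ n) (hn1 : n ≤ 1) :
    ‖stateVec u 1‖ ≤ Real.exp (8 * C ^ 2) * (2 * C) * ‖stateVec u n‖ := by
  have hC : 0 ≤ C := (norm_nonneg _).trans (hT n hn hn1 0 0)
  obtain ⟨m, rfl⟩ : ∃ m : ℕ, n = 1 - m := ⟨(1 - n).toNat, by omega⟩
  -- Leftwards from the site 1 the first equation used is the one at n = 1, and there are up to N +
  -- 1 steps. Now u(1-k) is the upper component of the new state vector.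
  have h := norm_le_exp_mul_of_norm_sub_le (y := fun k : ℕ => reducedVec V E u (1 - k))
    (κ := 4 * C ^ 2 * ‖z - E‖) (m := m) (fun k hk => by
      have h1 := norm_reducedVec_sub_le V E u (hu (1 - k) (by omega) (by omega))
        (hT (1 - k) (by omega) (by omega))
      have e : (1 : ℤ) - ((k + 1 : ℕ) : ℤ) = 1 - k - 1 := by push_cast; ring
      simp only [e]
      rw [norm_sub_rev]
      refine h1.trans ?_
      have h2 := norm_stateVec_le V E u (hT (1 - k - 1) (by omega) (by omega))
      have h3 : ‖u (1 - k)‖ ≤ ‖stateVec u (1 - k - 1)‖ := by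
        rw [norm_stateVec, sub_add_cancel]; exact le_max_left _ _
      calc 2 * C * (‖z - E‖ * ‖u (1 - k)‖)
          ≤ 2 * C * (‖z - E‖ * (2 * C * ‖reducedVec V E u (1 - k - 1)‖)) := by
            gcongr; exact h3.trans h2
        _ = _ := by ring)
  simp only [Nat.cast_zero, sub_zero, reducedVec_one] at h
  have h4 := norm_reducedVec_le V E u (hT (1 - m) hn hn1)
  have h5 : Real.exp (4 * C ^ 2 * ‖z - E‖ * m) ≤ Real.exp (8 * C ^ 2) := by
    rw [Real.exp_le_exp]
    have h6 : (m : ℝ) ≤ N + 1 := by exact_mod_cast (by omega : m ≤ N + 1)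
    have h7 : ‖z - E‖ * m ≤ 2 := (by gcongr : ‖z - E‖ * m ≤ ‖z - E‖ * (N + 1)).trans hz
    calc _ = 4 * C ^ 2 * (‖z - E‖ * m) := by ring
      _ ≤ 4 * C ^ 2 * 2 := by gcongr
      _ = _ := by ring
  calc _ ≤ _ := h
    _ ≤ Real.exp (8 * C ^ 2) * (2 * C * ‖stateVec u (1 - m)‖) := by gcongr
    _ = _ := by ring
end Reduced
end Transfer

/-! ### Damped signals and the stationary equation -/

section Damped
open scoped FourierTransform

/-- The damped signal `1_{t > 0} exp(-t/T) a(t)`. -/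
def damped (a : ℝ → ℂ) (T : ℝ) : ℝ → ℂ :=
  Set.indicator (Set.Ioi 0) fun t => (Real.exp (-t / T) : ℂ) * a t

theorem integrableOn_exp_mul {a : ℝ → ℂ} (ha : Continuous a) (h1 : ∀ t, ‖a t‖ ≤ 1) {z : ℂ}
    (hz : 0 < z.im) :
    IntegrableOn (fun t : ℝ => Complex.exp (Complex.I * z * t) * a t) (Set.Ioi 0) := by
  have h2 : IntegrableOn (fun t : ℝ => Real.exp (-z.im * t)) (Set.Ioi 0) :=
    exp_neg_integrableOn_Ioi 0 hz
  refine h2.mono' (by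
    refine Continuous.aestronglyMeasurable ?_
    fun_prop) (ae_of_all _ fun t => ?_)
  rw [norm_mul, Complex.norm_exp]
  have : (Complex.I * z * t).re = -z.im * t := by simp
  rw [this]
  exact mul_le_of_le_one_right (Real.exp_pos _).le (h1 t)

theorem exp_neg_div_mul (a : ℝ → ℂ) (T t : ℝ) :
    (Real.exp (-t / T) : ℂ) * a t = Complex.exp (Complex.I * (Complex.I * (1 / T : ℝ)) * t) * a t := by
  have : Complex.I * (Complex.I * (1 / T : ℝ)) * t = ((-t / T : ℝ) : ℂ) := by
    rw [← mul_assoc, Complex.I_mul_I]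
    push_cast
    ring
  rw [this, Complex.ofReal_exp]

theorem integrable_damped {a : ℝ → ℂ} (ha : Continuous a) (h1 : ∀ t, ‖a t‖ ≤ 1) {T : ℝ}
    (hT : 0 < T) : Integrable (damped a T) := by
  refine (integrable_indicator_iff measurableSet_Ioi).2 ?_
  simp only [exp_neg_div_mul]
  exact integrableOn_exp_mul ha h1 (by simpa using hT)

theorem norm_damped_le {a : ℝ → ℂ} (h1 : ∀ t, ‖a t‖ ≤ 1) {T : ℝ} (hT : 0 < T) (t : ℝ) :
    ‖damped a T t‖ ≤ 1 := by
  unfold damped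
  by_cases ht : t ∈ Set.Ioi (0 : ℝ)
  · rw [Set.indicator_of_mem ht, norm_mul, Complex.norm_real, Real.norm_of_nonneg (Real.exp_pos _).le]
    refine mul_le_one₀ ?_ (norm_nonneg _) (h1 t)
    rw [Real.exp_le_one_iff]
    have : 0 < t := ht
    rw [neg_div]
    exact neg_nonpos.2 (by positivity)
  · rw [Set.indicator_of_notMem ht]
    simp

theorem memLp_damped {a : ℝ → ℂ} (ha : Continuous a) (h1 : ∀ t, ‖a t‖ ≤ 1) {T : ℝ}
    (hT : 0 < T) : MemLp (damped a T) 2 := by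
  have hi := integrable_damped ha h1 hT
  rw [memLp_two_iff_integrable_sq_norm hi.aestronglyMeasurable]
  refine hi.norm.mono' (by fun_prop) (ae_of_all _ fun t => ?_)
  have := norm_damped_le h1 hT t
  rw [Real.norm_of_nonneg (by positivity)]
  nlinarith [norm_nonneg (damped a T t)]

/-- Damping at rate 1/T gives the energy -2πξ its imaginary part 1/T. -/
theorem fourier_damped (a : ℝ → ℂ) (T ξ : ℝ) :
    𝓕 (damped a T) ξ = ∫ t in Set.Ioi (0 : ℝ),
      Complex.exp (Complex.I * (((-2 * Real.pi * ξ : ℝ) : ℂ) + Complex.I * (1 / T : ℝ)) * t) * a t := by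
  rw [Real.fourier_eq', ← integral_indicator measurableSet_Ioi]
  refine integral_congr_ae (ae_of_all _ fun t => ?_)
  simp only [damped]
  by_cases ht : t ∈ Set.Ioi (0 : ℝ)
  · rw [Set.indicator_of_mem ht, Set.indicator_of_mem ht, exp_neg_div_mul, smul_eq_mul, ← mul_assoc,
      ← Complex.exp_add]
    congr 2
    simp
    ring
  · rw [Set.indicator_of_notMem ht, Set.indicator_of_notMem ht, smul_zero]

/-- The Laplace transform of a solution of the time-dependent equation solves the
stationary equation. -/
theorem integral_exp_mul_of_hasDerivAt {l c r : ℝ → ℂ} (hl : Continuous l) (hc : Continuous c)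
    (hr : Continuous r) (hl1 : ∀ t, ‖l t‖ ≤ 1) (hc1 : ∀ t, ‖c t‖ ≤ 1) (hr1 : ∀ t, ‖r t‖ ≤ 1)
    {v : ℂ} (hd : ∀ t, HasDerivAt c (-(Complex.I * (l t + r t + v * c t))) t) {z : ℂ}
    (hz : 0 < z.im) :
    (∫ t in Set.Ioi (0 : ℝ), Complex.exp (Complex.I * z * t) * r t) +
      (∫ t in Set.Ioi (0 : ℝ), Complex.exp (Complex.I * z * t) * l t) =
      (z - v) * (∫ t in Set.Ioi (0 : ℝ), Complex.exp (Complex.I * z * t) * c t) -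
        Complex.I * c 0 := by
  set e : ℝ → ℂ := fun t => Complex.exp (Complex.I * z * t) with he
  have il : Integrable (fun t => Complex.I * (e t * l t)) (volume.restrict (Set.Ioi 0)) :=
    (integrableOn_exp_mul hl hl1 hz).const_mul _
  have ic : Integrable (fun t => Complex.I * (z - v) * (e t * c t))
      (volume.restrict (Set.Ioi 0)) := (integrableOn_exp_mul hc hc1 hz).const_mul _
  have ir : Integrable (fun t => Complex.I * (e t * r t)) (volume.restrict (Set.Ioi 0)) :=
    (integrableOn_exp_mul hr hr1 hz).const_mul _
  have icr : Integrable (fun t => Complex.I * (z - v) * (e t * c t) - Complex.I * (e t * r t))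
      (volume.restrict (Set.Ioi 0)) := ic.sub ir
  have hde : ∀ t, HasDerivAt e (e t * (Complex.I * z)) t := by
    intro t
    have h1 : HasDerivAt (fun t : ℝ => Complex.I * z * (t : ℂ)) (Complex.I * z) t := by
      simpa using (hasDerivAt_id' t).ofReal_comp.const_mul (Complex.I * z)
    exact h1.cexp
  -- Integrating this derivative over (0, ∞) leaves only the boundary term at 0, which becomes the
  -- source.
  have hg : ∀ t, HasDerivAt (fun t => e t * c t)
      ((Complex.I * (z - v)) * (e t * c t) - Complex.I * (e t * r t) - Complex.I * (e t * l t)) t := by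
    intro t
    refine ((hde t).mul (hd t)).congr_deriv ?_
    ring
  have hint : Integrable (fun t => (Complex.I * (z - v)) * (e t * c t) - Complex.I * (e t * r t) -
      Complex.I * (e t * l t)) (volume.restrict (Set.Ioi 0)) :=
    icr.sub il
  have hlim : Tendsto (fun t => e t * c t) atTop (nhds 0) := by
    have h2 : Tendsto (fun t : ℝ => Real.exp (-(z.im * t))) atTop (nhds 0) :=
      Real.tendsto_exp_neg_atTop_nhds_zero.comp (tendsto_id.const_mul_atTop hz)
    refine squeeze_zero_norm (fun t => ?_) h2
    rw [norm_mul, he, Complex.norm_exp]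
    have : (Complex.I * z * t).re = -(z.im * t) := by simp
    rw [this]
    exact mul_le_of_le_one_right (Real.exp_pos _).le (hc1 t)
  have h := integral_Ioi_of_hasDerivAt_of_tendsto (a := 0)
    (hg 0).continuousAt.continuousWithinAt (fun t _ => hg t) hint hlim
  rw [integral_sub icr il, integral_sub ic ir, integral_const_mul, integral_const_mul,
    integral_const_mul] at h
  have e0 : e 0 = 1 := by simp [he]
  rw [e0, one_mul, zero_sub] at h
  show (∫ t in Set.Ioi (0 : ℝ), e t * r t) + (∫ t in Set.Ioi (0 : ℝ), e t * l t) =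
    (z - v) * (∫ t in Set.Ioi (0 : ℝ), e t * c t) - Complex.I * c 0
  linear_combination Complex.I * h +
    ((∫ t in Set.Ioi (0 : ℝ), e t * r t) + (∫ t in Set.Ioi (0 : ℝ), e t * l t) -
      (z - v) * (∫ t in Set.Ioi (0 : ℝ), e t * c t)) * Complex.I_sq
end Damped

/-! ### Time averages, moments and the growth exponent -/

section Dynamics
variable {ι : Type} [DecidableEq ι]

section
variable {τ : (ι → ℂ) →ₗ[ℂ] (ι → ℂ)} {o : ι}

theorem norm_amplitude_le (hU : ∃ U, IsUnitaryGroupOf (ellTwoOperator τ) U) (t : ℝ) (n : ι) :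
    ‖amplitude (ellTwoOperator τ) o t n‖ ≤ 1 := by
  refine (lp.norm_apply_le_norm (by norm_num) _ n).trans ?_
  rw [(unitaryGroup_spec hU).norm_map, lp.norm_single (by norm_num)]
  simp

theorem continuous_amplitude (hU : ∃ U, IsUnitaryGroupOf (ellTwoOperator τ) U) (n : ι) :
    Continuous fun t => amplitude (ellTwoOperator τ) o t n :=
  (lp.evalCLM ℂ (fun _ : ι => ℂ) 2 n).continuous.comp ((unitaryGroup_spec hU).continuous _)

theorem amplitude_zero (hU : ∃ U, IsUnitaryGroupOf (ellTwoOperator τ) U) (n : ι) :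
    amplitude (ellTwoOperator τ) o 0 n = if n = o then 1 else 0 := by
  rw [amplitude, (unitaryGroup_spec hU).map_zero]
  simp [lp.single_apply, Pi.single_apply]

theorem hasDerivAt_amplitude (hU : ∃ U, IsUnitaryGroupOf (ellTwoOperator τ) U)
    (ho : (lp.single 2 o (1 : ℂ) : EllTwo ι) ∈ (ellTwoOperator τ).domain) (t : ℝ) (n : ι) :
    HasDerivAt (fun t => amplitude (ellTwoOperator τ) o t n)
      (-(Complex.I * τ (amplitude (ellTwoOperator τ) o t) n)) t := by
  obtain ⟨φ, hφ⟩ : ∃ φ, ((lp.single 2 o (1 : ℂ) : EllTwo ι), φ) ∈ (ellTwoOperator τ).graph :=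
    ⟨_, (ellTwoOperator τ).mem_graph ⟨_, ho⟩⟩
  have h1 := (unitaryGroup_spec hU).hasDerivAt hφ t
  have h2 := mem_graph_ellTwoOperator.1 ((unitaryGroup_spec hU).map_graph hφ t)
  have h3 := ((lp.evalCLM ℂ (fun _ : ι => ℂ) 2 n).restrictScalars ℝ).hasFDerivAt.comp_hasDerivAt t h1
  have e : τ (amplitude (ellTwoOperator τ) o t) n =
      unitaryGroup (ellTwoOperator τ) t φ n := (congrFun h2 n).symm
  rw [e]
  exact h3
end

open scoped FourierTransform in
theorem timeAverage_eq_lintegral_fourier {H : EllTwo ι →ₗ.[ℂ] EllTwo ι} {o n : ι} {T : ℝ}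
    (hT : 0 < T) (hc : Continuous fun t => amplitude H o t n)
    (h1 : ∀ t, ‖amplitude H o t n‖ ≤ 1) :
    timeAverage H o n T = ENNReal.ofReal (1 / T) *
      ∫⁻ ξ, ENNReal.ofReal (‖𝓕 (damped (fun t => amplitude H o t n) T) ξ‖ ^ 2) := by
  rw [lintegral_norm_sq_fourier (integrable_damped hc h1 hT) (memLp_damped hc h1 hT), timeAverage,
    ← lintegral_indicator measurableSet_Ioi]
  congr 1
  refine lintegral_congr fun t => ?_
  unfold damped
  by_cases ht : t ∈ Set.Ioi (0 : ℝ)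
  · rw [Set.indicator_of_mem ht, Set.indicator_of_mem ht, norm_mul, Complex.norm_real,
      Real.norm_of_nonneg (Real.exp_pos _).le, mul_pow, ← Real.exp_nat_mul]
    congr 3
    push_cast
    ring
  · rw [Set.indicator_of_notMem ht, Set.indicator_of_notMem ht]
    simp

open scoped FourierTransform in
theorem le_moment {H : EllTwo ι →ₗ.[ℂ] EllTwo ι} {o : ι} {pos : ι → ℤ} {p T : ℝ} (hT : 0 < T)
    (hp : 0 ≤ p) (hc : ∀ n, Continuous fun t => amplitude H o t n)
    (h1 : ∀ t n, ‖amplitude H o t n‖ ≤ 1) {S : Finset ι} {K : ℝ} (hK : 0 ≤ K)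
    (hS : ∀ n ∈ S, K ≤ |(pos n : ℝ)|) {J : Set ℝ} (hJ : MeasurableSet J) {c : ℝ}
    (h : ∀ ξ ∈ J, c ≤ ∑ n ∈ S, ‖𝓕 (damped (fun t => amplitude H o t n) T) ξ‖ ^ 2) :
    ENNReal.ofReal (K ^ p) * (ENNReal.ofReal (1 / T) * (ENNReal.ofReal c * volume J)) ≤
      moment H o pos p T := by
  have hcont : ∀ n, Continuous (𝓕 (damped (fun t => amplitude H o t n) T)) := fun n =>
    VectorFourier.fourierIntegral_continuous Real.continuous_fourierChar
      (by fun_prop) (integrable_damped (hc n) (h1 · n) hT)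
  calc _ ≤ ENNReal.ofReal (K ^ p) * ∑ n ∈ S, timeAverage H o n T := by
        gcongr
        simp only [timeAverage_eq_lintegral_fourier hT (hc _) (h1 · _)]
        rw [← Finset.mul_sum, ← lintegral_finsetSum _ (fun n _ => by
          have := hcont n
          fun_prop)]
        gcongr
        calc ENNReal.ofReal c * volume J = ∫⁻ _ in J, ENNReal.ofReal c := by simp
          _ ≤ ∫⁻ ξ in J, ∑ n ∈ S,
              ENNReal.ofReal (‖𝓕 (damped (fun t => amplitude H o t n) T) ξ‖ ^ 2) := by
            refine setLIntegral_mono' hJ fun ξ hξ => ?_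
            rw [← ENNReal.ofReal_sum_of_nonneg fun _ _ => by positivity]
            exact ENNReal.ofReal_le_ofReal (h ξ hξ)
          _ ≤ _ := setLIntegral_le_lintegral _ _
    _ ≤ ∑ n ∈ S, ENNReal.ofReal (|(pos n : ℝ)| ^ p) * timeAverage H o n T := by
        rw [Finset.mul_sum]
        refine Finset.sum_le_sum fun n hn => ?_
        gcongr
        exact hS n hn
    _ ≤ _ := ENNReal.sum_le_tsum S

/-- The constant c is invisible in the exponent because log c / log T tends to 0. -/
theorem le_betaMinus {H : EllTwo ι →ₗ.[ℂ] EllTwo ι} {o : ι} {pos : ι → ℤ} {p q c T₀ : ℝ}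
    (hc : 0 < c)
    (h : ∀ T, T₀ ≤ T → ENNReal.ofReal (c * T ^ q) ≤ moment H o pos p T) :
    (q : EReal) ≤ betaMinus H o pos p := by
  have hlim : Tendsto (fun T : ℝ => ((Real.log c / Real.log T + q : ℝ) : EReal)) atTop
      (nhds (q : EReal)) := by
    refine (continuous_coe_real_ereal.tendsto q).comp ?_
    simpa using (Real.tendsto_log_atTop.const_div_atTop (Real.log c)).add_const q
  rw [← hlim.liminf_eq, betaMinus]
  refine liminf_le_liminf ?_
  filter_upwards [eventually_ge_atTop T₀, eventually_gt_atTop 1] with T hT hT1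
  have hlog : 0 < Real.log T := Real.log_pos hT1
  have hT0 : 0 < T := by linarith
  have e : ((Real.log c / Real.log T + q : ℝ) : EReal) =
      ((Real.log (c * T ^ q) : ℝ) : EReal) / ((Real.log T : ℝ) : EReal) := by
    rw [← EReal.coe_div, Real.log_mul hc.ne' (Real.rpow_pos_of_pos hT0 q).ne', Real.log_rpow hT0]
    congr 1
    field_simp
  rw [e]
  refine EReal.div_le_div_right_of_nonneg (by exact_mod_cast hlog.le) ?_
  have h2 : ((Real.log (c * T ^ q) : ℝ) : EReal) = ENNReal.log (ENNReal.ofReal (c * T ^ q)) := by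
    rw [ENNReal.log_ofReal_of_pos (by positivity)]
  rw [h2]
  exact ENNReal.log_monotone (h T hT)
end Dynamics

/-! ### From bounds on solutions to the exponent -/

section Assembly
open scoped FourierTransform

/-- Each of the K adjacent pairs contributes at least s², and a site lies in at most two pairs;
hence the factor 1/2 and the K + 1 sites. -/
theorem sum_norm_sq_ge_of_stateVec {u : ℤ → ℂ} {a : ℤ} {K : ℕ} {s : ℝ} (hs : 0 ≤ s)
    (h : ∀ n, a ≤ n → n < a + K → s ≤ ‖stateVec u n‖) :
    s ^ 2 / 2 * K ≤ ∑ k ∈ Finset.range (K + 1), ‖u (a + k)‖ ^ 2 := by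
  have h1 : ∑ k ∈ Finset.range K, s ^ 2 ≤
      ∑ k ∈ Finset.range K, (‖u (a + k)‖ ^ 2 + ‖u (a + (k + 1 : ℕ))‖ ^ 2) := by
    refine Finset.sum_le_sum fun k hk => ?_
    have hk' := Finset.mem_range.1 hk
    have h2 := h (a + k) (by omega) (by omega)
    rw [norm_stateVec] at h2
    have e : a + ((k + 1 : ℕ) : ℤ) = a + k + 1 := by push_cast; ring
    rw [e]
    rcases le_max_iff.1 h2 with h3 | h3
    · nlinarith [pow_le_pow_left₀ hs h3 2, sq_nonneg ‖u (a + k)‖]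
    · nlinarith [pow_le_pow_left₀ hs h3 2, sq_nonneg ‖u (a + k + 1)‖]
  rw [Finset.sum_add_distrib, Finset.sum_const, Finset.card_range, nsmul_eq_mul] at h1
  have h2 := Finset.sum_range_succ (fun k : ℕ => ‖u (a + k)‖ ^ 2) K
  have h3 := Finset.sum_range_succ' (fun k : ℕ => ‖u (a + k)‖ ^ 2) K
  have h4 : 0 ≤ ‖u (a + K)‖ ^ 2 := by positivity
  have h5 : 0 ≤ ‖u (a + (0 : ℕ))‖ ^ 2 := by positivity
  linarith

/-- The energy window has ξ-measure T^(-1/θ)/π, and K^p · T⁻¹ · cK times this measure is of order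
T^(p - 1/θ) for K comparable to T. -/
theorem le_betaMinus_of_window {ι : Type} [DecidableEq ι] {H : EllTwo ι →ₗ.[ℂ] EllTwo ι} {o : ι}
    {pos : ι → ℤ} {p θ E₀ c : ℝ} (hc : 0 < c) (hp : 0 < p)
    (hcont : ∀ n, Continuous fun t => amplitude H o t n) (h1 : ∀ t n, ‖amplitude H o t n‖ ≤ 1)
    (S : ℕ → Finset ι) (hS : ∀ K : ℕ, 1 ≤ K → ∀ n ∈ S K, (K : ℝ) ≤ |(pos n : ℝ)|)
    (h : ∀ (T : ℝ) (K : ℕ) (ξ : ℝ), 1 ≤ T → 1 ≤ K → (2 * K : ℝ) ≤ T →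
      |-2 * Real.pi * ξ - E₀| ≤ T ^ (-(1 / θ)) →
      c * K ≤ ∑ n ∈ S K, ‖𝓕 (damped (fun t => amplitude H o t n) T) ξ‖ ^ 2) :
    ((p - 1 / θ : ℝ) : EReal) ≤ betaMinus H o pos p := by
  refine le_betaMinus (c := (1 / 4) ^ p * (c / (4 * Real.pi))) (T₀ := 4)
    (by positivity) fun T hT => ?_
  have hT0 : 0 < T := by linarith
  -- 2K ≤ T keeps sites up to distance 2K within reach of the hypothesis; T ≥ 4 gives K ≥ T/4 ≥ 1.
  set K : ℕ := ⌊T / 2⌋₊ with hK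
  have hK2 : (K : ℝ) ≤ T / 2 := Nat.floor_le (by positivity)
  have hK4 : T / 4 ≤ K := by
    have := Nat.lt_floor_add_one (T / 2)
    rw [← hK] at this
    linarith
  have hK1 : 1 ≤ K := by
    have : (1 : ℝ) ≤ K := by linarith
    exact_mod_cast this
  set r := T ^ (-(1 / θ)) with hr
  have hr0 : 0 < r := Real.rpow_pos_of_pos hT0 _
  have hpi := Real.pi_pos
  have key := le_moment (H := H) (o := o) (pos := pos) hT0 hp.le hcont h1 (S := S K) (K := K)
    (Nat.cast_nonneg K) (hS K hK1)
    (J := Set.Icc ((-E₀ - r) / (2 * Real.pi)) ((-E₀ + r) / (2 * Real.pi))) measurableSet_Icc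
    (c := c * K) (fun ξ hξ => h T K ξ (by linarith) hK1 (by linarith) (by
      have h2 := (div_le_iff₀ (by positivity)).1 hξ.1
      have h3 := (le_div_iff₀ (by positivity)).1 hξ.2
      rw [abs_le]
      constructor <;> linarith))
  refine le_trans ?_ key
  have e : (-E₀ + r) / (2 * Real.pi) - (-E₀ - r) / (2 * Real.pi) = r / Real.pi := by
    field_simp
    ring
  rw [Real.volume_Icc, e, ← ENNReal.ofReal_mul (by positivity),
    ← ENNReal.ofReal_mul (by positivity), ← ENNReal.ofReal_mul (by positivity)]
  refine ENNReal.ofReal_le_ofReal ?_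
  have e2 : T ^ (p - 1 / θ) = T ^ p * r := by
    rw [hr, ← Real.rpow_add hT0, sub_eq_add_neg]
  calc (1 / 4) ^ p * (c / (4 * Real.pi)) * T ^ (p - 1 / θ)
      = (T / 4) ^ p * (1 / T * (c * (T / 4) * (r / Real.pi))) := by
        rw [e2, div_eq_mul_one_div T 4, Real.mul_rpow hT0.le (by norm_num)]
        field_simp
    _ ≤ (K : ℝ) ^ p * (1 / T * (c * K * (r / Real.pi))) := by gcongr

/-- The source of the exponent 1/θ: energies this close to E₀ satisfy the hypothesis at every site
up to distance T. -/
theorem mul_abs_rpow_le_one {T θ x m : ℝ} (hT : 1 ≤ T) (hθ : 1 ≤ θ)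
    (hx : |x| ≤ T ^ (-(1 / θ))) (hm : m ≤ T) : m * |x| ^ θ ≤ 1 := by
  have hT0 : 0 < T := by linarith
  have h1 : |x| ^ θ ≤ T⁻¹ := by
    calc |x| ^ θ ≤ (T ^ (-(1 / θ))) ^ θ := by gcongr
      _ = T⁻¹ := by
        rw [← Real.rpow_mul hT0.le, ← Real.rpow_neg_one]
        congr 1
        field_simp
  calc m * |x| ^ θ ≤ T * T⁻¹ := by gcongr
    _ = 1 := mul_inv_cancel₀ hT0.ne'

theorem abs_le_one_of_le_rpow {T θ x : ℝ} (hT : 1 ≤ T) (hθ : 1 ≤ θ)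
    (hx : |x| ≤ T ^ (-(1 / θ))) : |x| ≤ 1 := by
  refine hx.trans (Real.rpow_le_one_of_one_le_of_nonpos hT ?_)
  have : 0 < θ := by linarith
  exact neg_nonpos.2 (by positivity)

theorem norm_energy_sub (E T : ℝ) (hT : 0 < T) :
    ‖((E : ℂ) + Complex.I * (1 / T : ℝ)) - E‖ = 1 / T := by
  rw [add_sub_cancel_left, norm_mul, Complex.norm_I, one_mul, Complex.norm_real,
    Real.norm_of_nonneg (by positivity)]

/-- The neighbouring amplitudes l and r are left free so that l = 0 covers the Dirichlet boundary.
-/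
theorem fourier_damped_equation {ι : Type} [DecidableEq ι] {τ : (ι → ℂ) →ₗ[ℂ] (ι → ℂ)} {o n : ι}
    (hU : ∃ U, IsUnitaryGroupOf (ellTwoOperator τ) U)
    (ho : (lp.single 2 o (1 : ℂ) : EllTwo ι) ∈ (ellTwoOperator τ).domain)
    {l r : ℝ → ℂ} (hl : Continuous l) (hr : Continuous r) (hl1 : ∀ t, ‖l t‖ ≤ 1)
    (hr1 : ∀ t, ‖r t‖ ≤ 1) {v : ℂ}
    (hτ : ∀ t, τ (amplitude (ellTwoOperator τ) o t) n =
      l t + r t + v * amplitude (ellTwoOperator τ) o t n) {T : ℝ} (hT : 0 < T) (ξ : ℝ) :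
    𝓕 (damped r T) ξ + 𝓕 (damped l T) ξ =
      ((((-2 * Real.pi * ξ : ℝ) : ℂ) + Complex.I * (1 / T : ℝ)) - v) *
        𝓕 (damped (fun t => amplitude (ellTwoOperator τ) o t n) T) ξ -
      Complex.I * (if n = o then 1 else 0) := by
  rw [fourier_damped, fourier_damped, fourier_damped, ← amplitude_zero hU (o := o) n]
  refine integral_exp_mul_of_hasDerivAt hl (continuous_amplitude hU n) hr hl1
    (fun t => norm_amplitude_le hU t n) hr1 (v := v) (fun t => ?_) ?_
  · rw [← hτ]
    exact hasDerivAt_amplitude hU ho t n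
  · have : (((-2 * Real.pi * ξ : ℝ) : ℂ) + Complex.I * (1 / T : ℝ)).im = 1 / T := by
      rw [Complex.add_im, Complex.ofReal_im, Complex.I_mul_im, Complex.ofReal_re, zero_add]
    rw [this]
    positivity
end Assembly

/-! ### The whole line -/

section Line

theorem add_one_injective_int : Function.Injective fun n : ℤ => n + 1 := add_left_injective 1

theorem lineExpr_eq (V : ℤ → ℝ) (f : EllTwo ℤ) (n : ℤ) :
    lineExpr V f n = (pullback _ add_one_injective_int).adjoint f n +
      pullback _ add_one_injective_int f n + V n * f n := by
  have h := adjoint_pullback_apply _ add_one_injective_int f (n - 1)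
  simp only [sub_add_cancel] at h
  rw [h, pullback_apply]
  rfl

theorem exists_isUnitaryGroupOf_lineOperator (V : ℤ → ℝ) :
    ∃ U, IsUnitaryGroupOf (ellTwoOperator (lineExpr V)) U :=
  exists_isUnitaryGroupOf_of_pullback add_one_injective_int V (lineExpr_eq V)

open scoped FourierTransform in
theorem line_equation (V : ℤ → ℝ) {T : ℝ} (hT : 0 < T) (ξ : ℝ) (n : ℤ) :
    𝓕 (damped (fun t => amplitude (lineOperator V) 1 t (n + 1)) T) ξ +
      𝓕 (damped (fun t => amplitude (lineOperator V) 1 t (n - 1)) T) ξ =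
    ((((-2 * Real.pi * ξ : ℝ) : ℂ) + Complex.I * (1 / T : ℝ)) - V n) *
        𝓕 (damped (fun t => amplitude (lineOperator V) 1 t n) T) ξ -
      Complex.I * (if n = 1 then 1 else 0) := by
  have hU := exists_isUnitaryGroupOf_lineOperator V
  exact fourier_damped_equation hU
    (single_mem_domain_of_pullback add_one_injective_int V (lineExpr_eq V) 1)
    (continuous_amplitude hU _) (continuous_amplitude hU _)
    (fun t => norm_amplitude_le hU t _) (fun t => norm_amplitude_le hU t _)
    (fun t => rfl) hT ξ

/-- The hypothesis omits n = 0, which the estimate to the left must cross; there the matrix is the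
inverse of a single step. -/
theorem norm_transferMatrix_zero_one_entry_le (V : ℤ → ℝ) (E : ℂ) (i j : Fin 2) :
    ‖transferMatrix V 0 1 E i j‖ ≤ ‖E‖ + |V 1| + 1 := by
  have h : transferMatrix V 0 1 E = (stepMatrix V 1 E)⁻¹ := by
    simp [transferMatrix, stepProd]
  have h1 : ‖E - V 1‖ ≤ ‖E‖ + |V 1| := by
    refine (norm_sub_le _ _).trans ?_
    rw [Complex.norm_real, Real.norm_eq_abs]
  have h2 := norm_nonneg (E - V 1)
  rw [h, Matrix.inv_def, det_stepMatrix, Ring.inverse_one, one_smul, stepMatrix,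
    Matrix.adjugate_fin_two_of]
  fin_cases i <;> fin_cases j <;> simp <;> linarith

theorem line_lower_bound (C E₀ θ : ℝ) (hθ : 1 ≤ θ) (V : ℤ → ℝ)
    (hV : ∀ (n : ℤ) (E : ℝ), n ≠ 0 → |(n : ℝ)| * |E - E₀| ^ θ ≤ 1 →
      ‖transferMatrix V n 1 (E : ℂ)‖ ≤ C) (p : ℝ) (hp : 0 < p) :
    ((p - 1 / θ : ℝ) : EReal) ≤ lineBetaMinus V p := by
  have hU := exists_isUnitaryGroupOf_lineOperator V
  -- The second entry covers the site 0, using |E| ≤ |E₀| + 1.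
  set C' : ℝ := max C (|E₀| + 1 + |V 1| + 1) with hC'
  have hC'0 : 0 < C' := lt_max_of_lt_right (by positivity)
  set D : ℝ := Real.exp (8 * C' ^ 2) * (2 * C') with hD
  have hD0 : 0 < D := by positivity
  set s : ℝ := 1 / (2 * D) with hs
  have hs0 : 0 < s := by positivity
  refine le_betaMinus_of_window (c := s ^ 2 / 2) (E₀ := E₀) (by positivity) hp
    (fun n => continuous_amplitude hU n) (fun t n => norm_amplitude_le hU t n)
    (fun K => (Finset.range (K + 1)).image (fun k : ℕ => (K : ℤ) + k) ∪
      (Finset.range (K + 1)).image (fun k : ℕ => -2 * (K : ℤ) + k)) ?_ ?_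
  · intro K hK n hn
    have : (K : ℤ) ≤ |n| := by
      rcases Finset.mem_union.1 hn with hn | hn
      · obtain ⟨k, hk, rfl⟩ := Finset.mem_image.1 hn
        exact le_abs.2 (Or.inl (by omega))
      · obtain ⟨k, hk, rfl⟩ := Finset.mem_image.1 hn
        have := Finset.mem_range.1 hk
        exact le_abs.2 (Or.inr (by omega))
    exact_mod_cast this
  intro T K ξ hT hK hKT hξ
  have hT0 : 0 < T := by linarith
  set E : ℝ := -2 * Real.pi * ξ with hE
  set z : ℂ := (E : ℂ) + Complex.I * (1 / T : ℝ) with hz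
  obtain ⟨u, hu⟩ : ∃ u : ℤ → ℂ, ∀ n, u n =
      FourierTransform.fourier (damped (fun t => amplitude (lineOperator V) 1 t n) T) ξ :=
    ⟨_, fun n => rfl⟩
  have heq : ∀ n, u (n + 1) + u (n - 1) = (z - V n) * u n - Complex.I * (if n = 1 then 1 else 0) :=
    fun n => by rw [hu, hu, hu]; exact line_equation V hT0 ξ n
  have hzE : ‖z - E‖ = 1 / T := norm_energy_sub E T hT0
  have hE1 : |E - E₀| ≤ 1 := abs_le_one_of_le_rpow hT hθ hξ
  have htr : ∀ n : ℤ, -(2 * K : ℕ) ≤ n → n ≤ (2 * K : ℕ) → ∀ i j,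
      ‖transferMatrix V n 1 (E : ℂ) i j‖ ≤ C' := by
    intro n hn1 hn2 i j
    by_cases hn : n = 0
    · subst hn
      refine (norm_transferMatrix_zero_one_entry_le V E i j).trans (le_max_of_le_right ?_)
      rw [Complex.norm_real, Real.norm_eq_abs]
      have := abs_sub_abs_le_abs_sub E E₀
      linarith
    · refine (norm_entry_le_l2_opNorm _ i j).trans (le_max_of_le_left (hV n E hn ?_))
      refine mul_abs_rpow_le_one hT hθ hξ ?_
      have h1 : |n| ≤ (2 * K : ℕ) := abs_le.2 ⟨hn1, hn2⟩
      have h2 : |(n : ℝ)| ≤ ((2 * K : ℕ) : ℝ) := by exact_mod_cast h1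
      refine h2.trans ?_
      push_cast
      exact hKT
  have hzK : ‖z - E‖ * ((2 * K : ℕ) + 1) ≤ 2 := by
    rw [hzE]
    push_cast
    rw [div_mul_eq_mul_div, div_le_iff₀ hT0]
    linarith
  have hzK' : ‖z - E‖ * (2 * K : ℕ) ≤ 2 := by
    have := norm_nonneg (z - E)
    linarith
  -- Shifting the value at 2 by i absorbs the source: w solves the homogeneous equation for all n ≤
  -- 1, while u solves it for n ≥ 2. Their values at 2 differ by i, so their state vectors at 1
  -- cannot both be shorter than 1/2.
  set w : ℤ → ℂ := fun n => if n = 2 then u 2 + Complex.I else u n with hw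
  have hw2 : w 2 = u 2 + Complex.I := by simp [hw]
  have hwn : ∀ n, n ≤ 1 → w n = u n := fun n hn => by simp [hw, show n ≠ 2 by omega]
  have hsum : (1 : ℝ) ≤ ‖stateVec u 1‖ + ‖stateVec w 1‖ := by
    have h1 : ‖u 2‖ ≤ ‖stateVec u 1‖ := by rw [norm_stateVec]; exact le_max_left _ _
    have h2 : ‖u 2 + Complex.I‖ ≤ ‖stateVec w 1‖ := by
      rw [norm_stateVec, ← hw2]; exact le_max_left _ _
    have h3 : ‖Complex.I‖ ≤ ‖u 2 + Complex.I‖ + ‖u 2‖ := by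
      have := norm_sub_le (u 2 + Complex.I) (u 2)
      rwa [add_sub_cancel_left] at this
    rw [Complex.norm_I] at h3
    linarith
  have hhalf : ∀ x y : ℝ, 1 / 2 ≤ x → x ≤ D * y → s ≤ y := by
    intro x y hx hxy
    rw [hs, div_le_iff₀ (by positivity)]
    linarith
  simp only [← hu]
  -- A large state of u is propagated right to [K, 2K]; otherwise that of w is propagated left to
  -- [-2K, -K], where w = u.
  rcases le_or_gt (1 / 2) ‖stateVec u 1‖ with hbig | hsmall
  · have h1 := sum_norm_sq_ge_of_stateVec (u := u) (a := K) (K := K) hs0.le fun n hn1 hn2 =>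
      hhalf _ _ hbig (norm_stateVec_one_le_right V E u hzK' (N := 2 * K)
        (fun n hn hn' => htr n (by omega) hn')
        (fun n hn _ => by rw [heq, if_neg (by omega), mul_zero, sub_zero])
        (by omega) (by omega))
    refine h1.trans ?_
    rw [← Finset.sum_image (f := fun n : ℤ => ‖u n‖ ^ 2) (g := fun k : ℕ => (K : ℤ) + k)
      (fun a _ b _ hab => by simpa using hab)]
    exact Finset.sum_le_sum_of_subset_of_nonneg Finset.subset_union_left
      fun _ _ _ => by positivity
  · have hbig : 1 / 2 ≤ ‖stateVec w 1‖ := by linarith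
    have h1 := sum_norm_sq_ge_of_stateVec (u := w) (a := -2 * K) (K := K) hs0.le fun n hn1 hn2 =>
      hhalf _ _ hbig (norm_stateVec_one_le_left V E w hzK (N := 2 * K)
        (fun n hn hn' => htr n hn (by omega))
        (fun n _ hn => by
          have h2 := heq n
          rw [hwn n hn, hwn (n - 1) (by omega)]
          rcases eq_or_lt_of_le hn with rfl | hlt
          · rw [show (1 : ℤ) + 1 = 2 by norm_num, hw2]
            rw [show (1 : ℤ) + 1 = 2 by norm_num, if_pos rfl] at h2
            linear_combination h2
          · rw [hwn (n + 1) (by omega), h2, if_neg hlt.ne, mul_zero, sub_zero])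
        (by push_cast; omega) (by omega))
    refine h1.trans ?_
    have h2 : ∑ k ∈ Finset.range (K + 1), ‖w (-2 * K + k)‖ ^ 2 =
        ∑ k ∈ Finset.range (K + 1), ‖u (-2 * K + k)‖ ^ 2 :=
      Finset.sum_congr rfl fun k hk => by
        have := Finset.mem_range.1 hk
        rw [hwn _ (by omega)]
    rw [h2, ← Finset.sum_image (f := fun n : ℤ => ‖u n‖ ^ 2)
      (g := fun k : ℕ => -2 * (K : ℤ) + k) (fun a _ b _ hab => by simpa using hab)]
    exact Finset.sum_le_sum_of_subset_of_nonneg Finset.subset_union_right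
      fun _ _ _ => by positivity
end Line

/-! ### The half-line -/

section HalfLine

theorem add_one_injective_pnat : Function.Injective fun n : ℕ+ => n + 1 := add_left_injective 1

/-- The Dirichlet condition is built into the adjoint shift: 1 is not of the form m + 1, so the
adjoint vanishes there. -/
theorem halfLineExpr_eq (V : ℕ+ → ℝ) (f : EllTwo ℕ+) (n : ℕ+) :
    halfLineExpr V f n = (pullback _ add_one_injective_pnat).adjoint f n +
      pullback _ add_one_injective_pnat f n + V n * f n := by
  have h : (pullback _ add_one_injective_pnat).adjoint f n = if n = 1 then 0 else f (n - 1) := by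
    split_ifs with hn
    · refine adjoint_pullback_apply_of_notMem _ _ f n fun m hm => ?_
      rw [hn] at hm
      have h := congrArg (fun k : ℕ+ => (k : ℕ)) hm
      simp at h
    · have h := adjoint_pullback_apply _ add_one_injective_pnat f (n - 1)
      rwa [PNat.sub_add_of_lt (lt_of_le_of_ne one_le (Ne.symm hn))] at h
  rw [h, pullback_apply]
  rfl

theorem exists_isUnitaryGroupOf_halfLineOperator (V : ℕ+ → ℝ) :
    ∃ U, IsUnitaryGroupOf (ellTwoOperator (halfLineExpr V)) U :=
  exists_isUnitaryGroupOf_of_pullback add_one_injective_pnat V (halfLineExpr_eq V)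

open scoped FourierTransform in
theorem halfLine_equation_one (V : ℕ+ → ℝ) {T : ℝ} (hT : 0 < T) (ξ : ℝ) :
    𝓕 (damped (fun t => amplitude (halfLineOperator V) 1 t 2) T) ξ =
    ((((-2 * Real.pi * ξ : ℝ) : ℂ) + Complex.I * (1 / T : ℝ)) - V 1) *
        𝓕 (damped (fun t => amplitude (halfLineOperator V) 1 t 1) T) ξ - Complex.I := by
  have hU := exists_isUnitaryGroupOf_halfLineOperator V
  have h := fourier_damped_equation hU
    (single_mem_domain_of_pullback add_one_injective_pnat V (halfLineExpr_eq V) 1)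
    (n := 1) (l := fun _ => 0) continuous_const (continuous_amplitude hU 2)
    (fun t => by simp) (fun t => norm_amplitude_le hU t _) (v := V 1)
    (fun t => rfl) hT ξ
  have h0 : 𝓕 (damped (fun _ => 0) T) ξ = 0 := by
    rw [fourier_damped]
    simp
  rw [h0, add_zero, if_pos rfl, mul_one] at h
  exact h

open scoped FourierTransform in
theorem halfLine_equation (V : ℕ+ → ℝ) {T : ℝ} (hT : 0 < T) (ξ : ℝ) {n : ℕ+} (hn : n ≠ 1) :
    𝓕 (damped (fun t => amplitude (halfLineOperator V) 1 t (n + 1)) T) ξ +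
      𝓕 (damped (fun t => amplitude (halfLineOperator V) 1 t (n - 1)) T) ξ =
    ((((-2 * Real.pi * ξ : ℝ) : ℂ) + Complex.I * (1 / T : ℝ)) - V n) *
        𝓕 (damped (fun t => amplitude (halfLineOperator V) 1 t n) T) ξ := by
  have hU := exists_isUnitaryGroupOf_halfLineOperator V
  have h := fourier_damped_equation hU
    (single_mem_domain_of_pullback add_one_injective_pnat V (halfLineExpr_eq V) 1)
    (n := n) (continuous_amplitude (o := 1) hU (n - 1)) (continuous_amplitude (o := 1) hU (n + 1))
    (fun t => norm_amplitude_le hU t _) (fun t => norm_amplitude_le hU t _) (v := V n)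
    (fun t => by
      simp only [halfLineExpr, LinearMap.coe_mk, AddHom.coe_mk, if_neg hn]) hT ξ
  rwa [if_neg hn, mul_zero, sub_zero] at h

/-- No choice of direction is needed: the equation at the site 1 reads u(2) = (z - V(1))u(1) - i,
which by itself keeps (u(2), u(1)) away from 0. -/
theorem halfLine_lower_bound (C E₀ θ : ℝ) (hC : 0 < C) (hθ : 1 ≤ θ) (V : ℕ+ → ℝ)
    (hV : ∀ (n : ℕ+) (E : ℝ), |(n : ℝ)| * |E - E₀| ^ θ ≤ 1 →
        ‖halfLineTransferMatrix V n 1 (E : ℂ)‖ ≤ C) (p : ℝ) (hp : 0 < p) :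
    ((p - 1 / θ : ℝ) : EReal) ≤ halfLineBetaMinus V p := by
  have hU := exists_isUnitaryGroupOf_halfLineOperator V
  have hinj : Function.Injective fun k : ℕ+ => (k : ℤ) := fun a b h => by
    simpa using h
  -- Bounds |z - V(1)|, from |E| ≤ |E₀| + 1 and 1/T ≤ 1.
  set M : ℝ := |E₀| + 1 + 1 + |V 1| with hM
  set D : ℝ := Real.exp (8 * C ^ 2) * (2 * C) with hD
  have hD0 : 0 < D := by positivity
  set s : ℝ := 1 / ((1 + M) * D) with hs
  have hs0 : 0 < s := by positivity
  refine le_betaMinus_of_window (c := s ^ 2 / 2) (E₀ := E₀) (by positivity) hp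
    (fun n => continuous_amplitude hU n) (fun t n => norm_amplitude_le hU t n)
    (fun K => (Finset.range (K + 1)).image (fun k : ℕ => (K + k).toPNat')) ?_ ?_
  · intro K hK n hn
    obtain ⟨k, hk, rfl⟩ := Finset.mem_image.1 hn
    have h1 : (((K + k).toPNat' : ℕ+) : ℕ) = K + k := PNat.toPNat'_coe (by omega)
    have : (K : ℤ) ≤ |(((K + k).toPNat' : ℕ+) : ℤ)| := by
      refine le_abs.2 (Or.inl ?_)
      have h2 : (((K + k).toPNat' : ℕ+) : ℤ) = ((((K + k).toPNat' : ℕ+) : ℕ) : ℤ) := rfl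
      rw [h2, h1]
      omega
    exact_mod_cast this
  intro T K ξ hT hK hKT hξ
  have hT0 : 0 < T := by linarith
  set E : ℝ := -2 * Real.pi * ξ with hE
  set z : ℂ := (E : ℂ) + Complex.I * (1 / T : ℝ) with hz
  set W : ℤ → ℝ := Function.extend (fun k : ℕ+ => (k : ℤ)) V 0 with hW
  obtain ⟨f, hf⟩ : ∃ f : ℕ+ → ℂ, ∀ n, f n =
      FourierTransform.fourier (damped (fun t => amplitude (halfLineOperator V) 1 t n) T) ξ :=
    ⟨_, fun n => rfl⟩
  -- Extension to ℤ gives access to the transfer estimates; only sites n ≥ 1 are ever read.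
  set u : ℤ → ℂ := Function.extend (fun k : ℕ+ => (k : ℤ)) f 0 with hu
  have hWn : ∀ n : ℕ+, W n = V n := fun n => hinj.extend_apply V 0 n
  have hun : ∀ n : ℕ+, u n = f n := fun n => hinj.extend_apply f 0 n
  have heq1 : u 2 = (z - V 1) * u 1 - Complex.I := by
    have h1 := hun 1
    have h2 := hun 2
    simp only [PNat.val_ofNat, Nat.cast_one, Nat.cast_ofNat] at h1 h2
    rw [h1, h2, hf, hf]
    exact halfLine_equation_one V hT0 ξ
  have heq : ∀ n : ℤ, 2 ≤ n → u (n + 1) + u (n - 1) = (z - W n) * u n := by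
    intro n hn
    obtain ⟨m, rfl⟩ : ∃ m : ℕ+, n = m := ⟨⟨n.toNat, by omega⟩, by simp; omega⟩
    have hm : m ≠ 1 := by rintro rfl; simp at hn
    have h1 : ((m + 1 : ℕ+) : ℤ) = (m : ℤ) + 1 := by simp
    have h2 : ((m - 1 : ℕ+) : ℤ) = (m : ℤ) - 1 := by
      have := PNat.sub_add_of_lt (lt_of_le_of_ne one_le (Ne.symm hm))
      have h3 := congrArg (fun k : ℕ+ => (k : ℤ)) this
      simp only [PNat.add_coe, PNat.one_coe, Nat.cast_add, Nat.cast_one] at h3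
      omega
    rw [← h1, ← h2, hun, hun, hun, hWn, hf, hf, hf]
    exact halfLine_equation V hT0 ξ hm
  have hzE : ‖z - E‖ = 1 / T := norm_energy_sub E T hT0
  have hE1 : |E - E₀| ≤ 1 := abs_le_one_of_le_rpow hT hθ hξ
  have htr : ∀ n : ℤ, 1 ≤ n → n ≤ (2 * K : ℕ) → ∀ i j,
      ‖transferMatrix W n 1 (E : ℂ) i j‖ ≤ C := by
    intro n hn1 hn2 i j
    obtain ⟨m, rfl⟩ : ∃ m : ℕ+, n = m := ⟨⟨n.toNat, by omega⟩, by simp; omega⟩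
    refine (norm_entry_le_l2_opNorm _ i j).trans (hV m E ?_)
    refine mul_abs_rpow_le_one hT hθ hξ ?_
    have h1 : (m : ℝ) ≤ ((2 * K : ℕ) : ℝ) := by exact_mod_cast hn2
    rw [abs_of_nonneg (by positivity)]
    refine h1.trans ?_
    push_cast
    exact hKT
  have hzK : ‖z - E‖ * (2 * K : ℕ) ≤ 2 := by
    rw [hzE]
    push_cast
    rw [div_mul_eq_mul_div, div_le_iff₀ hT0]
    linarith
  have hone : 1 ≤ (1 + M) * ‖stateVec u 1‖ := by
    have h1 : ‖u 2‖ ≤ ‖stateVec u 1‖ := by rw [norm_stateVec]; exact le_max_left _ _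
    have h2 : ‖u 1‖ ≤ ‖stateVec u 1‖ := by rw [norm_stateVec]; exact le_max_right _ _
    have h3 : ‖z - V 1‖ ≤ M := by
      have e : z - V 1 = (z - E) + ((E - V 1 : ℝ) : ℂ) := by push_cast; ring
      have h4 : 1 / T ≤ 1 := by rw [div_le_one hT0]; exact hT
      rw [e]
      refine (norm_add_le _ _).trans ?_
      rw [hzE, Complex.norm_real, Real.norm_eq_abs]
      have h5 := abs_sub_abs_le_abs_sub E E₀
      have h6 := abs_sub E (V 1)
      rw [hM]
      linarith
    have h7 : Complex.I = (z - V 1) * u 1 - u 2 := by rw [heq1]; ring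
    have h8 : ‖Complex.I‖ ≤ ‖(z - V 1) * u 1‖ + ‖u 2‖ := by
      rw [h7]; exact norm_sub_le _ _
    rw [Complex.norm_I, norm_mul] at h8
    have h9 : ‖z - V 1‖ * ‖u 1‖ ≤ M * ‖stateVec u 1‖ := by gcongr
    linarith
  have h1 := sum_norm_sq_ge_of_stateVec (u := u) (a := K) (K := K) hs0.le fun n hn1 hn2 => by
    have h2 := norm_stateVec_one_le_right W E u hzK htr
      (fun n hn _ => heq n hn) (n := n) (by omega) (by push_cast; omega)
    rw [hs, div_le_iff₀ (by positivity)]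
    calc 1 ≤ (1 + M) * ‖stateVec u 1‖ := hone
      _ ≤ (1 + M) * (D * ‖stateVec u n‖) := by gcongr
      _ = _ := by ring
  refine h1.trans (le_of_eq ?_)
  rw [Finset.sum_image (fun a _ b _ hab => by
    have h2 := congrArg (fun k : ℕ+ => (k : ℕ)) hab
    simp only [PNat.toPNat'_coe (show 0 < K + a by omega),
      PNat.toPNat'_coe (show 0 < K + b by omega)] at h2
    omega)]
  refine Finset.sum_congr rfl fun k _ => ?_
  rw [← hf, ← hun]
  have h2 : (((K + k).toPNat' : ℕ+) : ℕ) = K + k := PNat.toPNat'_coe (by omega)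
  rw [h2]
  push_cast
  rfl
end HalfLine

end

theorem corollary2 (C E₀ θ : ℝ) (hC : 0 < C) (hθ : 1 ≤ θ) :
    (∀ V : ℤ → ℝ,
      (∀ (n : ℤ) (E : ℝ), n ≠ 0 → |(n : ℝ)| * |E - E₀| ^ θ ≤ 1 →
        ‖transferMatrix V n 1 (E : ℂ)‖ ≤ C) →
      ∀ p : ℝ, 0 < p → ((p - 1 / θ : ℝ) : EReal) ≤ lineBetaMinus V p) ∧
    (∀ V : ℕ+ → ℝ,
      (∀ (n : ℕ+) (E : ℝ), |(n : ℝ)| * |E - E₀| ^ θ ≤ 1 →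
        ‖halfLineTransferMatrix V n 1 (E : ℂ)‖ ≤ C) →
      ∀ p : ℝ, 0 < p → ((p - 1 / θ : ℝ) : EReal) ≤ halfLineBetaMinus V p) :=
  ⟨fun V hV p hp => line_lower_bound C E₀ θ hθ V hV p hp,
    fun V hV p hp => halfLine_lower_bound C E₀ θ hC hθ V hV p hp⟩
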